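/- Let $d\in\mathbb N$, let $\alpha$ be an a.s. positive random variable and $\xi$ a random vector in $\mathbb R^d$, let $(\alpha_t)_{t\ge1}$ and $(\xi_t)_{t\ge1}$ be two independent sequences of i.i.d. copies of $\alpha$ and of $\xi$, let $\beta\in\mathbb R$, $\gamma>0$, and let $A\subseteq\mathbb R^d$ be a measurable set with $B(0,\underline r)\subseteq A\subseteq B(0,\overline r)$ for some $\underline r,\overline r\in(0,\infty)$, where $B(0,r)$ is the open Euclidean ball. Put $X_0=Y_0=0$ and, for $t\ge0$, $$X_{t+1}=\alpha_{t+1}X_t+\beta\xi_{t+1},\qquad Y_{t+1}=\alpha_{t+1}Y_t\mathbf 1\{Y_t\notin\gamma A\}+\beta\xi_{t+1},\qquad \tau=\min\{t\ge1:\ X_t\in\gamma A\}\le\infty .$$ A probability measure $\pi$ on $\mathbb R^d$ is called stationary for $(Y_t)$ if $\alpha Y\mathbf 1\{Y\notin\gamma A\}+\beta\xi$ has law $\pi$ whenever $Y,\alpha,\xi$ are independent and $Y$ has law $\pi$. Assume that $\mathbb P(\alpha\in[d/(d+1),1))>0$, that $\alpha$ is integrable with $\mathbb E\alpha<1$, that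 $\mathbb E\|\xi\|^2<\infty$ and $\mathbb E\xi=0$, and that the matrix $\mathbb E\xi\xi^T$ has full rank. Then: (i) $\tau<\infty$ almost surely, and $\mathbb E e^{c\tau}<\infty$ for some $c>0$. (ii) The chain $(Y_t)$ has exactly one stationary distribution $\pi$, and for every measurable $B\subseteq\mathbb R^d$ $$\pi(B)=\frac1{\mathbb E\tau}\,\mathbb E\sum_{j=1}^{\tau}\mathbf 1\{X_j\in B\}=\frac1{\mathbb E\tau}\,\mathbb E\sum_{j=1}^{\infty}\mathbf 1\{X_j\in B\}\mathbf 1\{\tau\ge j\}.$$ If moreover the cycle length $\tau$ is aperiodic, i.e. $\gcd\{t\ge1:\ \mathbb P(\tau=t)>0\}=1$, then the law of $Y_t$ converges to $\pi$ in the total variation norm as $t\to\infty$. (iii) For every $c>1$: if $\mathbb E\alpha^c<1$ and $\mathbb E\|\xi\|^c<\infty$, then $\int\|y\|^c\,\pi(dy)<\infty$, i.e. $\mathbb E\|Y\|^c<\infty$ for a random vector $Y$ with law $\pi$. -/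

import Mathlib

open MeasureTheory ProbabilityTheory Filter Topology
open scoped ENNReal Pointwise

/-- The autoregressive sequence `X 0 = 0`, `X (t + 1) = α_{t+1} X t + β ξ_{t+1}`.
The driving sequences are indexed from `0`: `α t` and `ξ t` are the variables used in the step
from time `t` to time `t + 1`. -/
def arSeq {Ω : Type*} {d : ℕ} (β : ℝ) (α : ℕ → Ω → ℝ) (ξ : ℕ → Ω → EuclideanSpace ℝ (Fin d)) :
    ℕ → Ω → EuclideanSpace ℝ (Fin d)
  | 0, _ => 0
  | t + 1, ω => α t ω • arSeq β α ξ t ω + β • ξ t ω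

/-- One step of the recursion with restart set `S`: `(y, a, x) ↦ a y 1{y ∉ S} + β x`. -/
noncomputable def restartStep {d : ℕ} (β : ℝ) (S : Set (EuclideanSpace ℝ (Fin d)))
    (p : EuclideanSpace ℝ (Fin d) × ℝ × EuclideanSpace ℝ (Fin d)) : EuclideanSpace ℝ (Fin d) :=
  p.2.1 • Sᶜ.indicator id p.1 + β • p.2.2

/-- The sequence with restart: `Y 0 = 0`, `Y (t + 1) = α_{t+1} (Y t) 1{Y t ∉ S} + β ξ_{t+1}`. -/
noncomputable def restartSeq {Ω : Type*} {d : ℕ} (β : ℝ) (S : Set (EuclideanSpace ℝ (Fin d)))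
    (α : ℕ → Ω → ℝ) (ξ : ℕ → Ω → EuclideanSpace ℝ (Fin d)) :
    ℕ → Ω → EuclideanSpace ℝ (Fin d)
  | 0, _ => 0
  | t + 1, ω => restartStep β S (restartSeq β S α ξ t ω, α t ω, ξ t ω)

/-- The restart time `min {t ≥ 1 : X t ∈ S}`, equal to `⊤` if there is no such `t`. -/
noncomputable def restartTime {Ω : Type*} {d : ℕ} (β : ℝ) (S : Set (EuclideanSpace ℝ (Fin d)))
    (α : ℕ → Ω → ℝ) (ξ : ℕ → Ω → EuclideanSpace ℝ (Fin d)) : Ω → ℕ∞ :=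
  hittingAfter (arSeq β α ξ) S 1

/-- `π` is a stationary law of the chain with restart: if `Y`, `α`, `ξ` are independent with laws
`π`, `μα`, `μξ`, then `α Y 1{Y ∉ S} + β ξ` has law `π` again. -/
def IsStationaryLaw {d : ℕ} (β : ℝ) (S : Set (EuclideanSpace ℝ (Fin d)))
    (μα : Measure ℝ) (μξ : Measure (EuclideanSpace ℝ (Fin d)))
    (π : Measure (EuclideanSpace ℝ (Fin d))) : Prop :=
  (π.prod (μα.prod μξ)).map (restartStep β S) = π

/-!
The law of the chain with restart changes in one step by `ν ↦ ν(S) η + K ν`, where `S = γ • A`, `η`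
is the law of `β ξ`, and `K` is one step of the autoregression killed in `S`
(`killedStep`, `regenStep`, `map_restartStep`). The measure `K^j η` is the law of `X_{j+1}` on the
event `{τ ≥ j + 1}` (`map_restrict_avoids_arSeq`), so the occupation measure of a cycle is
`G = ∑ j, K^j η` and its total mass is `E τ`.

*Tails of the cycle.* Since `E α < 1`, the function `‖x‖` has a linear drift towards a ball. From
every ball the autoregression enters a prescribed neighbourhood of the origin after a fixed number
of steps, with a probability bounded below (`exists_pow_arKernel_ball_ge`). To see this, fix a point
`a ∈ [d / (d + 1), 1)` of the support of `α`. The mean `0` of the noise is a limit of points of the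
convex hull of its support; by Carathéodory's theorem such a point `y` is a convex combination of at
most `d + 1` support points, one of the weights is at least `1 / (d + 1) ≥ 1 - a`, hence
`y = (1 - a) v + a y'` with `v` in the support and `y'` in the same simplex. Iterating this expands
`y / (1 - a)` in powers of `a` with support points as digits, which tells how to steer the
autoregression to the origin. The Foster–Lyapunov criterion (`exists_contraction_of_drift`) then
shows that some `1 + ε ‖x‖` is contracted by a power of the killed chain. Therefore `P(τ > j)` decays
geometrically, and the killed chain dies out from every initial law.

*Stationarity.* A cycle visits `S` exactly once, so `G(S) = 1` and `G = η + K G` says that `G` is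
invariant. Conversely an invariant probability `π'` satisfies
`π' = π'(S) ∑_{j < n} K^j η + K^n π'`, and the last term vanishes in the limit
(`eq_smul_cycleOccupation_of_regenStep_eq`).

*Convergence.* Decomposing at the last visit to `S` gives the law at time `n + 1` as
`∑_{i + j = n} u_i K^j η`, where `u_i` are the renewal probabilities. For geometric tails the renewal
theorem has a short analytic proof (`tendsto_renewal`): with `M(z) = ∑ P(τ > n) z^n` one has
`U(z) M(z) = 1 / (1 - z)`, aperiodicity excludes zeros of `M` on the closed unit disc, and so
`u_n`, the partial sums of the coefficients of `1 / M`, converge to `1 / M(1) = 1 / E τ`. Dominated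
convergence turns this into convergence in total variation.

*Moments.* If `E α^c < 1`, then `‖x‖^c` also satisfies a linear drift inequality, and summing it over
a cycle bounds its integral against `G` (`lintegral_cycleOccupation_lt_top`).
-/

/-! ### The renewal theorem with geometric tails -/

theorem HasSum.congr_terms {ι R : Type*} [AddCommMonoid R] [TopologicalSpace R] {f g : ι → R}
    {a b : R} (h : HasSum f a) (hfg : ∀ i, f i = g i) (hab : a = b) : HasSum g b := by
  obtain rfl : f = g := funext hfg
  exact hab ▸ h

/-- A power series with constant sum on the unit disc has no coefficients of positive order. -/
theorem coeff_eq_of_hasSum_const {a : ℕ → ℂ} {w : ℂ}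
    (h : ∀ z : ℂ, ‖z‖ < 1 → HasSum (fun n => a n * z ^ n) w) (n : ℕ) :
    a n = if n = 0 then w else 0 := by
  have h1 : HasFPowerSeriesAt (fun _ : ℂ => w) (FormalMultilinearSeries.ofScalars ℂ a) 0 := by
    rw [hasFPowerSeriesAt_iff]
    filter_upwards [Metric.ball_mem_nhds (0 : ℂ) one_pos] with z hz
    simpa [FormalMultilinearSeries.coeff_ofScalars, mul_comm] using
      h z (by simpa using hz)
  have h2 := h1.eq_formalMultilinearSeries (hasFPowerSeriesAt_const (𝕜 := ℂ) (c := w)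
    (e := (0 : ℂ)))
  have h3 := congrArg (fun p => FormalMultilinearSeries.coeff p n) h2
  rw [FormalMultilinearSeries.coeff_ofScalars] at h3
  rw [h3]
  rcases n with _ | n <;> simp [FormalMultilinearSeries.coeff, constFormalMultilinearSeries]

theorem hasSum_increments_mul_pow {M : ℕ → ℝ} {z : ℂ} (hM0 : M 0 = 1)
    (hs : Summable fun n => (M n : ℂ) * z ^ n) :
    HasSum (fun n => ((M n - M (n + 1) : ℝ) : ℂ) * z ^ (n + 1))
      (1 - (1 - z) * ∑' n, (M n : ℂ) * z ^ n) := by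
  have h1 : HasSum (fun n => (M (n + 1) : ℂ) * z ^ (n + 1)) ((∑' n, (M n : ℂ) * z ^ n) - 1) := by
    have := (hasSum_nat_add_iff' (f := fun n => (M n : ℂ) * z ^ n) 1).2 hs.hasSum
    simpa [hM0] using this
  have h2 := (hs.hasSum.mul_right z).sub h1
  exact h2.congr_terms (fun n => by push_cast; ring) (by ring)

/-- Aperiodicity keeps the generating function of the tails `M` away from zero on the closed unit
disc. Let `f (t + 1) = M t - M (t + 1)` be the distribution with tails `M`. At a zero `z` one has
`∑ f k * z ^ k = 1 = ∑ f k`, which forces `z ^ k = 1` on the support of `f`; so the order of `z`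
divides the support and `z = 1`, but `∑ M n ≥ M 0 = 1`. -/
theorem tsum_tail_ne_zero {M : ℕ → ℝ} (hM0 : M 0 = 1) (hanti : Antitone M) (hnn : ∀ n, 0 ≤ M n)
    (hsum : Summable M) (hap : ∀ n, (∀ t, M t - M (t + 1) ≠ 0 → n ∣ t + 1) → n = 1)
    {z : ℂ} (hz : ‖z‖ ≤ 1) : ∑' n, (M n : ℂ) * z ^ n ≠ 0 := by
  intro h0
  have hs : Summable fun n => (M n : ℂ) * z ^ n := by
    refine Summable.of_norm_bounded hsum fun n => ?_
    rw [norm_mul, norm_pow, Complex.norm_real, Real.norm_of_nonneg (hnn n)]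
    exact mul_le_of_le_one_right (hnn n) (pow_le_one₀ (norm_nonneg _) hz)
  have h1 := hasSum_increments_mul_pow hM0 hs
  rw [h0] at h1
  have hf : HasSum (fun n => M n - M (n + 1)) 1 := by
    have h2 : HasSum (fun n => M (n + 1)) ((∑' n, M n) - 1) := by
      simpa [hM0] using (hasSum_nat_add_iff' (f := M) 1).2 hsum.hasSum
    simpa using hsum.hasSum.sub h2
  have h3 : HasSum (fun n => (M n - M (n + 1)) * (1 - (z ^ (n + 1)).re)) 0 := by
    have h4 := hf.sub (Complex.hasSum_re h1)
    exact h4.congr_terms (fun n => by rw [Complex.re_ofReal_mul]; ring) (by simp)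
  have hre : ∀ n, (z ^ n).re ≤ 1 := fun n =>
    (Complex.re_le_norm _).trans (by rw [norm_pow]; exact pow_le_one₀ (norm_nonneg _) hz)
  have h5 := (hasSum_zero_iff_of_nonneg fun n =>
    mul_nonneg (sub_nonneg.2 (hanti n.le_succ)) (sub_nonneg.2 (hre (n + 1)))).1 h3
  have h6 : ∀ t, M t - M (t + 1) ≠ 0 → z ^ (t + 1) = 1 := by
    intro t ht
    have h7 := congrFun h5 t
    simp only [Pi.zero_apply, mul_eq_zero, ht, false_or] at h7
    have h8 : (z ^ (t + 1)).re = 1 := by linarith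
    have h9 : ‖z ^ (t + 1)‖ ≤ 1 := by
      rw [norm_pow]; exact pow_le_one₀ (norm_nonneg _) hz
    have h10 : (z ^ (t + 1)).re ^ 2 + (z ^ (t + 1)).im ^ 2 ≤ 1 := by
      have := Complex.sq_norm (z ^ (t + 1))
      rw [Complex.normSq_apply] at this
      nlinarith [norm_nonneg (z ^ (t + 1))]
    have h11 : (z ^ (t + 1)).im = 0 := by
      rw [h8] at h10
      exact pow_eq_zero_iff two_ne_zero |>.1 (le_antisymm (by linarith) (sq_nonneg _))
    exact Complex.ext h8 h11
  have h7 : orderOf z = 1 := hap _ fun t ht => orderOf_dvd_of_pow_eq_one (h6 t ht)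
  rw [orderOf_eq_one_iff] at h7
  subst h7
  simp only [one_pow, mul_one] at h0
  rw [← Complex.ofReal_tsum] at h0
  have h8 : M 0 ≤ ∑' n, M n := hsum.le_tsum 0 fun n _ => hnn n
  rw [Complex.ofReal_eq_zero.1 h0, hM0] at h8
  linarith

/-- The renewal theorem for an aperiodic cycle length with geometric tails. Here `M n` is the
probability that the cycle is longer than `n` and `u n` the probability of a renewal at time `n`;
the hypothesis on `u` says that exactly one renewal is the last one up to time `n`.
The generating functions satisfy `U(z) M(z) = 1 / (1 - z)`, and `1 / M` is analytic on a disc of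
radius greater than `1`, so the partial sums `u n` of its coefficients converge to `1 / M(1)`. -/
theorem tendsto_renewal {M u : ℕ → ℝ} {C r : ℝ} (hr : 0 < r) (hr1 : r < 1)
    (hM0 : M 0 = 1) (hanti : Antitone M) (hnn : ∀ n, 0 ≤ M n) (hdec : ∀ n, M n ≤ C * r ^ n)
    (hu : ∀ n, ∑ p ∈ Finset.HasAntidiagonal.antidiagonal n, u p.1 * M p.2 = 1)
    (hap : ∀ n, (∀ t, M t - M (t + 1) ≠ 0 → n ∣ t + 1) → n = 1) :
    Tendsto u atTop (𝓝 (∑' n, M n)⁻¹) := by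
  -- on the disc of radius `R > 1` the series of `M` is still dominated by a geometric series
  obtain ⟨R, hR1, hRr⟩ := exists_between ((one_lt_inv₀ hr).2 hr1)
  have hR0 : 0 < R := one_pos.trans hR1
  have hrR : r * R < 1 := by
    have := mul_lt_mul_of_pos_left hRr hr
    rwa [mul_inv_cancel₀ hr.ne'] at this
  have hbd : Summable fun n => C * (r * R) ^ n :=
    (summable_geometric_of_lt_one (by positivity) hrR).mul_left C
  have hterm : ∀ n, ∀ z : ℂ, ‖z‖ ≤ R → ‖(M n : ℂ) * z ^ n‖ ≤ C * (r * R) ^ n := by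
    intro n z hz
    rw [norm_mul, norm_pow, Complex.norm_real, Real.norm_of_nonneg (hnn n), mul_pow, ← mul_assoc]
    exact mul_le_mul (hdec n) (pow_le_pow_left₀ (norm_nonneg _) hz n) (by positivity)
      ((hnn n).trans (hdec n))
  have hsum : Summable M := by
    refine Summable.of_nonneg_of_le hnn hdec ((summable_geometric_of_lt_one hr.le hr1).mul_left C)
  set F : ℂ → ℂ := fun z => ∑' n, (M n : ℂ) * z ^ n with hF
  have hFd : DifferentiableOn ℂ F (Metric.ball 0 R) := by
    refine Complex.differentiableOn_tsum_of_summable_norm hbd (fun n => by fun_prop)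
      Metric.isOpen_ball fun n z hz => hterm n z ?_
    exact (mem_ball_zero_iff.1 hz).le
  have hopen : IsOpen (Metric.ball (0 : ℂ) R ∩ F ⁻¹' {0}ᶜ) :=
    hFd.continuousOn.isOpen_inter_preimage Metric.isOpen_ball isOpen_compl_singleton
  obtain ⟨δ, hδ, hsub⟩ := (isCompact_closedBall (0 : ℂ) 1).exists_thickening_subset_open hopen
    (fun z hz => ⟨Metric.closedBall_subset_ball hR1 hz,
      tsum_tail_ne_zero hM0 hanti hnn hsum hap (mem_closedBall_zero_iff.1 hz)⟩)
  rw [thickening_closedBall hδ zero_le_one] at hsub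
  -- a radius larger than `1` for which the closed disc is still free of zeros of `F`
  set R' : NNReal := ⟨1 + δ / 2, by positivity⟩ with hR'
  have hR'0 : 0 < R' := by
    rw [← NNReal.coe_pos, hR']; change 0 < 1 + δ / 2; positivity
  have hR'1 : (1 : ℝ) < R' := by change 1 < 1 + δ / 2; linarith
  have hsub' : Metric.closedBall (0 : ℂ) R' ⊆ Metric.ball 0 R ∩ F ⁻¹' {0}ᶜ := by
    refine (Metric.closedBall_subset_ball ?_).trans hsub
    change 1 + δ / 2 < δ + 1; linarith
  have hgd : DifferentiableOn ℂ (fun z => (F z)⁻¹) (Metric.closedBall 0 R') :=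
    (hFd.mono fun z hz => (hsub' hz).1).fun_inv fun z hz => (hsub' hz).2
  have hps := hgd.hasFPowerSeriesOnBall hR'0
  set p := cauchyPowerSeries (fun z => (F z)⁻¹) 0 R'
  have hmem : ∀ z : ℂ, ‖z‖ ≤ 1 → z ∈ Metric.eball (0 : ℂ) R' := by
    intro z hz
    rw [Metric.mem_eball, edist_zero_right, enorm_eq_nnnorm]
    exact_mod_cast (show (‖z‖₊ : ℝ) < R' by simpa using hz.trans_lt hR'1)
  have hc : ∀ z : ℂ, ‖z‖ ≤ 1 → HasSum (fun n => p.coeff n * z ^ n) (F z)⁻¹ := by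
    intro z hz
    simpa [mul_comm] using hps.hasSum (hmem z hz)
  have hcn : ∀ z : ℂ, ‖z‖ ≤ 1 → Summable fun n => ‖p.coeff n * z ^ n‖ := fun z hz => by
    have := p.summable_norm_apply (Metric.eball_subset_eball hps.r_le (hmem z hz))
    simpa [mul_comm] using this
  have hMn : ∀ z : ℂ, ‖z‖ ≤ 1 → Summable fun n => ‖(M n : ℂ) * z ^ n‖ := fun z hz =>
    Summable.of_nonneg_of_le (fun _ => norm_nonneg _) (fun n => hterm n z (hz.trans hR1.le)) hbd
  -- The coefficients of `1 / M` are inverse to those of `M` as formal power series.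
  have hinv : (PowerSeries.mk fun n => p.coeff n) * (PowerSeries.mk fun n => (M n : ℂ)) = 1 := by
    ext n
    rw [PowerSeries.coeff_one]
    refine coeff_eq_of_hasSum_const (a := fun n => PowerSeries.coeff n
      ((PowerSeries.mk fun n => p.coeff n) * (PowerSeries.mk fun n => (M n : ℂ))))
      (fun z hz => ?_) n
    have h1 := tsum_mul_tsum_eq_tsum_sum_antidiagonal_of_summable_norm (hcn z hz.le) (hMn z hz.le)
    have h2 := (summable_norm_sum_mul_antidiagonal_of_summable_norm
      (hcn z hz.le) (hMn z hz.le)).of_norm.hasSum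
    rw [← h1, (hc z hz.le).tsum_eq] at h2
    have h3 : F z ≠ 0 :=
      tsum_tail_ne_zero hM0 hanti hnn hsum hap hz.le
    rw [show (∑' n, (M n : ℂ) * z ^ n) = F z from rfl, inv_mul_cancel₀ h3] at h2
    refine h2.congr_terms (fun k => ?_) rfl
    rw [PowerSeries.coeff_mul, Finset.sum_mul]
    refine Finset.sum_congr rfl fun q hq => ?_
    rw [← Finset.HasAntidiagonal.mem_antidiagonal.1 hq, PowerSeries.coeff_mk, PowerSeries.coeff_mk, pow_add]
    ring
  have hconv : (PowerSeries.mk fun n => (u n : ℂ)) * (PowerSeries.mk fun n => (M n : ℂ)) =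
      PowerSeries.mk fun _ => 1 := by
    ext n
    rw [PowerSeries.coeff_mul, PowerSeries.coeff_mk]
    simp only [PowerSeries.coeff_mk]
    exact_mod_cast hu n
  have hU : (PowerSeries.mk fun n => (u n : ℂ)) =
      (PowerSeries.mk fun n => p.coeff n) * PowerSeries.mk fun _ => 1 := by
    rw [← hconv, mul_comm (PowerSeries.mk fun n => (u n : ℂ)), ← mul_assoc, hinv, one_mul]
  have hun : ∀ n, (u n : ℂ) = ∑ i ∈ Finset.range (n + 1), p.coeff i := by
    intro n
    have := congrArg (PowerSeries.coeff n) hU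
    rw [PowerSeries.coeff_mk, PowerSeries.coeff_mul] at this
    rw [this, Finset.Nat.sum_antidiagonal_eq_sum_range_succ_mk]
    simp
  have h1 := (hc 1 (by simp)).tendsto_sum_nat.comp (tendsto_add_atTop_nat 1)
  have h2 : Tendsto (fun n => (u n : ℂ)) atTop (𝓝 (((∑' n, M n)⁻¹ : ℝ) : ℂ)) := by
    convert h1 using 1
    · ext n; simp [hun n]
    · simp [hF, Complex.ofReal_tsum]
  simpa [Function.comp_def] using (Complex.continuous_re.tendsto _).comp h2

/-! ### Regeneration: cycle decomposition of a restarted chain -/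

theorem totalVariation_sub_le_of_le_add {E : Type*} [MeasurableSpace E] {μ ν m : Measure E}
    [IsFiniteMeasure μ] [IsFiniteMeasure ν] (h₁ : ∀ B, MeasurableSet B → μ B ≤ ν B + m B)
    (h₂ : ∀ B, MeasurableSet B → ν B ≤ μ B + m B) :
    (μ.toSignedMeasure - ν.toSignedMeasure).totalVariation Set.univ ≤ m Set.univ := by
  rw [SignedMeasure.totalVariation_eq_variation]
  refine VectorMeasure.variation_le_of_forall_enorm_le (fun B hB => ?_) _
  rw [Measure.toSignedMeasure_sub_apply hB]
  by_cases hm : m B = ⊤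
  · simp [hm]
  rw [← ofReal_norm, Real.norm_eq_abs]
  refine ENNReal.ofReal_le_of_le_toReal (abs_sub_le_iff.2 ⟨?_, ?_⟩)
  · have := ENNReal.toReal_mono (by finiteness) (h₁ B hB)
    rw [ENNReal.toReal_add (by finiteness) hm] at this
    simp only [measureReal_def]; linarith
  · have := ENNReal.toReal_mono (by finiteness) (h₂ B hB)
    rw [ENNReal.toReal_add (by finiteness) hm] at this
    simp only [measureReal_def]; linarith

section Regeneration

variable {E : Type*} [MeasurableSpace E]

/-- One step of the Markov chain with transition kernel `κ` killed in `S`, acting on measures: the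
mass sitting in `S` is removed and the rest moves according to `κ`. -/
noncomputable def killedStep (κ : Kernel E E) (S : Set E) : Measure E →ₗ[ℝ≥0∞] Measure E where
  toFun ν := κ ∘ₘ ν.restrict Sᶜ
  map_add' μ ν := by rw [Measure.restrict_add, Measure.comp_add]
  map_smul' c ν := by rw [Measure.restrict_smul, Measure.comp_smul, RingHom.id_apply]

/-- One step of the Markov chain restarted at `x₀` whenever it is in `S`, acting on measures. -/
noncomputable def regenStep (κ : Kernel E E) (S : Set E) (x₀ : E) (ν : Measure E) : Measure E :=
  ν S • κ x₀ + killedStep κ S ν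

/-- The law at time `n + 1` of the chain started at `x₀`, on the event that it has avoided `S` at
the times `1, …, n`. -/
noncomputable def excursion (κ : Kernel E E) (S : Set E) (x₀ : E) (n : ℕ) : Measure E :=
  (killedStep κ S)^[n] (κ x₀)

/-- The occupation measure of a cycle: the expected number of visits during times `1, …, τ`, where
`τ` is the first time `≥ 1` at which the chain started at `x₀` is in `S`. -/
noncomputable def cycleOccupation (κ : Kernel E E) (S : Set E) (x₀ : E) : Measure E :=
  Measure.sum (excursion κ S x₀)

variable {κ : Kernel E E} {S : Set E} {x₀ : E}

theorem excursion_zero : excursion κ S x₀ 0 = κ x₀ := rfl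

theorem excursion_succ (n : ℕ) :
    excursion κ S x₀ (n + 1) = killedStep κ S (excursion κ S x₀ n) := by
  rw [excursion, Function.iterate_succ_apply', excursion]

theorem lintegral_killedStep (ν : Measure E) {g : E → ℝ≥0∞} (hg : Measurable g) :
    ∫⁻ y, g y ∂killedStep κ S ν = ∫⁻ x in Sᶜ, ∫⁻ y, g y ∂κ x ∂ν :=
  Measure.lintegral_bind κ.aemeasurable hg.aemeasurable

theorem killedStep_apply (ν : Measure E) {B : Set E} (hB : MeasurableSet B) :
    killedStep κ S ν B = ∫⁻ x in Sᶜ, κ x B ∂ν :=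
  Measure.bind_apply hB κ.aemeasurable

theorem killedStep_univ [IsMarkovKernel κ] (ν : Measure E) :
    killedStep κ S ν Set.univ = ν Sᶜ := by
  simp [killedStep_apply ν MeasurableSet.univ]

theorem killedStep_sum (ν : ℕ → Measure E) :
    killedStep κ S (Measure.sum ν) = Measure.sum fun n => killedStep κ S (ν n) := by
  change Measure.bind _ _ = _
  rw [Measure.restrict_sum_of_countable, Measure.bind_sum _ _ κ.aemeasurable]
  rfl

theorem killedStep_iterate_univ_le [IsMarkovKernel κ] (ν : Measure E) (n : ℕ) :
    (killedStep κ S)^[n] ν Set.univ ≤ ν Set.univ := by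
  induction n with
  | zero => rfl
  | succ n ih =>
    rw [Function.iterate_succ_apply', killedStep_univ]
    exact (measure_mono (Set.subset_univ _)).trans ih

theorem excursion_univ_le_one [IsMarkovKernel κ] (n : ℕ) :
    excursion κ S x₀ n Set.univ ≤ 1 :=
  (killedStep_iterate_univ_le _ n).trans_eq (by simp)

theorem excursion_univ_succ_add [IsMarkovKernel κ] (hS : MeasurableSet S) (n : ℕ) :
    excursion κ S x₀ n S + excursion κ S x₀ (n + 1) Set.univ =
      excursion κ S x₀ n Set.univ := by
  rw [excursion_succ, killedStep_univ, measure_add_measure_compl hS]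

theorem cycleOccupation_apply {B : Set E} (hB : MeasurableSet B) :
    cycleOccupation κ S x₀ B = ∑' n, excursion κ S x₀ n B :=
  Measure.sum_apply _ hB

theorem cycleOccupation_eq_add :
    cycleOccupation κ S x₀ = κ x₀ + killedStep κ S (cycleOccupation κ S x₀) := by
  rw [cycleOccupation, killedStep_sum]
  ext B hB
  rw [Measure.add_apply, Measure.sum_apply _ hB, Measure.sum_apply _ hB,
    tsum_eq_zero_add' ENNReal.summable]
  simp only [excursion_zero, excursion_succ]

/-- The chain visits `S` exactly once in a cycle of finite mean length. -/
theorem cycleOccupation_self [IsMarkovKernel κ] (hS : MeasurableSet S)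
    (hfin : cycleOccupation κ S x₀ Set.univ ≠ ⊤) : cycleOccupation κ S x₀ S = 1 := by
  have h1 : cycleOccupation κ S x₀ S + cycleOccupation κ S x₀ Sᶜ =
      1 + cycleOccupation κ S x₀ Sᶜ := by
    rw [measure_add_measure_compl hS]
    conv_lhs => rw [cycleOccupation_eq_add]
    rw [Measure.add_apply, killedStep_univ, measure_univ]
  exact (ENNReal.add_left_inj (measure_ne_top_of_subset (Set.subset_univ _) hfin)).1 h1

theorem cycleOccupation_univ_ne_zero [IsMarkovKernel κ] :
    cycleOccupation κ S x₀ Set.univ ≠ 0 := by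
  rw [cycleOccupation_eq_add, Measure.add_apply, measure_univ]
  simp

theorem regenStep_smul (c : ℝ≥0∞) (ν : Measure E) :
    regenStep κ S x₀ (c • ν) = c • regenStep κ S x₀ ν := by
  rw [regenStep, regenStep, map_smul, smul_add, Measure.smul_apply, smul_eq_mul, mul_smul]

theorem regenStep_cycleOccupation [IsMarkovKernel κ] (hS : MeasurableSet S)
    (hfin : cycleOccupation κ S x₀ Set.univ ≠ ⊤) :
    regenStep κ S x₀ (cycleOccupation κ S x₀) = cycleOccupation κ S x₀ := by
  rw [regenStep, cycleOccupation_self hS hfin, one_smul, ← cycleOccupation_eq_add]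

theorem regenStep_univ [IsMarkovKernel κ] (hS : MeasurableSet S) (ν : Measure E) :
    regenStep κ S x₀ ν Set.univ = ν Set.univ := by
  rw [regenStep, Measure.add_apply, killedStep_univ, Measure.smul_apply, measure_univ, smul_eq_mul,
    mul_one, measure_add_measure_compl hS]

/-- A stationary law is recovered from its last visit to `S`: it is a multiple of the occupation
measure of a cycle, provided the chain started from it visits `S` almost surely. -/
theorem eq_smul_cycleOccupation_of_regenStep_eq [IsMarkovKernel κ]
    {ν : Measure E} [IsProbabilityMeasure ν] (hν : regenStep κ S x₀ ν = ν)
    (hkill : Tendsto (fun n => (killedStep κ S)^[n] ν Set.univ) atTop (𝓝 0)) :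
    ν = (cycleOccupation κ S x₀ Set.univ)⁻¹ • cycleOccupation κ S x₀ := by
  have h1 : ∀ n, ν = ν S • (∑ j ∈ Finset.range n, excursion κ S x₀ j) +
      (killedStep κ S)^[n] ν := by
    intro n
    induction n with
    | zero => simp
    | succ n ih =>
      have h2 : (killedStep κ S)^[n] ν =
          ν S • excursion κ S x₀ n + (killedStep κ S)^[n + 1] ν := by
        conv_lhs => rw [← hν]
        rw [regenStep, iterate_map_add, Function.iterate_succ_apply]
        congr 1
        rw [← Module.End.coe_pow, map_smul, Module.End.coe_pow, excursion]
      conv_lhs => rw [ih, h2]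
      rw [Finset.sum_range_succ, smul_add, add_assoc]
  have h2 : ν = ν S • cycleOccupation κ S x₀ := by
    ext B hB
    rw [Measure.smul_apply, cycleOccupation_apply hB, smul_eq_mul]
    have h3 : Tendsto (fun n => ν S * ∑ j ∈ Finset.range n, excursion κ S x₀ j B +
        (killedStep κ S)^[n] ν B) atTop
        (𝓝 (ν S * ∑' n, excursion κ S x₀ n B + 0)) := by
      refine Tendsto.add ?_ ?_
      · exact ENNReal.Tendsto.const_mul (ENNReal.tendsto_nat_tsum _) (Or.inr (by finiteness))
      · exact tendsto_of_tendsto_of_tendsto_of_le_of_le tendsto_const_nhds hkill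
          (fun _ => zero_le) (fun _ => measure_mono (Set.subset_univ _))
    rw [add_zero] at h3
    refine tendsto_nhds_unique (tendsto_const_nhds.congr fun n => ?_) h3
    conv_lhs => rw [h1 n]
    simp
  have h3 : ν S * cycleOccupation κ S x₀ Set.univ = 1 := by
    rw [← smul_eq_mul, ← Measure.smul_apply, ← h2, measure_univ]
  conv_lhs => rw [h2]
  rw [ENNReal.eq_inv_of_mul_eq_one_left h3]

/-- The probability that the chain with restarts, started in `S`, is in `S` at time `n`. -/
noncomputable def regenProb (κ : Kernel E E) (S : Set E) (x₀ : E) : ℕ → ℝ≥0∞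
  | 0 => 1
  | n + 1 => (regenStep κ S x₀)^[n] (κ x₀) S

/-- Decomposition according to the last visit to `S`. -/
theorem regenStep_iterate_eq_sum (n : ℕ) :
    (regenStep κ S x₀)^[n] (κ x₀) = ∑ p ∈ Finset.HasAntidiagonal.antidiagonal n,
      regenProb κ S x₀ p.1 • excursion κ S x₀ p.2 := by
  induction n with
  | zero => simp [regenProb, excursion_zero]
  | succ n ih =>
    rw [Finset.Nat.sum_antidiagonal_succ', Function.iterate_succ_apply', regenStep,
      excursion_zero]
    congr 1
    rw [ih, map_sum]
    refine Finset.sum_congr rfl fun p _ => ?_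
    rw [map_smul, excursion_succ]

theorem regenStep_iterate_univ [IsMarkovKernel κ] (hS : MeasurableSet S) (n : ℕ) :
    (regenStep κ S x₀)^[n] (κ x₀) Set.univ = 1 := by
  induction n with
  | zero => simp
  | succ n ih => rw [Function.iterate_succ_apply', regenStep_univ hS, ih]

theorem regenProb_le_one [IsMarkovKernel κ] (hS : MeasurableSet S) (n : ℕ) :
    regenProb κ S x₀ n ≤ 1 := by
  cases n with
  | zero => rfl
  | succ n => exact (measure_mono (Set.subset_univ _)).trans (regenStep_iterate_univ hS n).le

theorem tendsto_regenProb [IsMarkovKernel κ] (hS : MeasurableSet S) {C r : ℝ} (hr : 0 < r)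
    (hr1 : r < 1) (hdec : ∀ n, (excursion κ S x₀ n Set.univ).toReal ≤ C * r ^ n)
    (hap : ∀ n, (∀ t, excursion κ S x₀ t S ≠ 0 → n ∣ t + 1) → n = 1) :
    Tendsto (fun n => (regenProb κ S x₀ n).toReal) atTop
      (𝓝 ((cycleOccupation κ S x₀ Set.univ)⁻¹).toReal) := by
  have hfin : ∀ n, excursion κ S x₀ n Set.univ ≠ ⊤ := fun n =>
    ((excursion_univ_le_one n).trans_lt ENNReal.one_lt_top).ne
  have hfinS : ∀ n, excursion κ S x₀ n S ≠ ⊤ := fun n =>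
    measure_ne_top_of_subset (Set.subset_univ _) (hfin n)
  have hstep : ∀ n, (excursion κ S x₀ n Set.univ).toReal -
      (excursion κ S x₀ (n + 1) Set.univ).toReal = (excursion κ S x₀ n S).toReal := by
    intro n
    rw [← excursion_univ_succ_add hS n, ENNReal.toReal_add (hfinS n) (hfin _)]
    ring
  have key := tendsto_renewal (M := fun n => (excursion κ S x₀ n Set.univ).toReal)
    (u := fun n => (regenProb κ S x₀ n).toReal) hr hr1 (by simp [excursion_zero])
    (antitone_nat_of_succ_le fun n => by
      have := hstep n
      have h := ENNReal.toReal_nonneg (a := excursion κ S x₀ n S)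
      linarith)
    (fun _ => ENNReal.toReal_nonneg) hdec
    (fun n => by
      have h1 := congrArg (fun ν => (ν Set.univ).toReal)
        (regenStep_iterate_eq_sum (κ := κ) (S := S) (x₀ := x₀) n)
      simp only [regenStep_iterate_univ hS, Measure.finsetSum_apply, Measure.smul_apply,
        smul_eq_mul] at h1
      rw [ENNReal.toReal_sum fun p _ => ENNReal.mul_ne_top
        ((regenProb_le_one hS _).trans_lt ENNReal.one_lt_top).ne (hfin _)] at h1
      simpa [ENNReal.toReal_mul] using h1.symm)
    (fun n h => hap n fun t ht => h t (by
      rw [hstep t]; exact ENNReal.toReal_ne_zero.2 ⟨ht, hfinS t⟩))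
  rwa [ENNReal.toReal_inv, cycleOccupation_apply MeasurableSet.univ, ENNReal.tsum_toReal_eq hfin]

/-- Convergence in total variation of the chain with restarts, for an aperiodic cycle length with
geometric tails. -/
theorem tendsto_totalVariation_regenStep [IsMarkovKernel κ] (hS : MeasurableSet S) {C r : ℝ}
    (hr : 0 < r) (hr1 : r < 1)
    (hdec : ∀ n, (excursion κ S x₀ n Set.univ).toReal ≤ C * r ^ n)
    (hfin : cycleOccupation κ S x₀ Set.univ ≠ ⊤)
    (hap : ∀ n, (∀ t, excursion κ S x₀ t S ≠ 0 → n ∣ t + 1) → n = 1)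
    {a : ℕ → Measure E} [∀ n, IsFiniteMeasure (a n)] {π : Measure E} [IsFiniteMeasure π]
    (ha : ∀ n, a n = (regenStep κ S x₀)^[n] (κ x₀))
    (hπ : π = (cycleOccupation κ S x₀ Set.univ)⁻¹ • cycleOccupation κ S x₀) :
    Tendsto (fun n => ((a n).toSignedMeasure - π.toSignedMeasure).totalVariation Set.univ)
      atTop (𝓝 0) := by
  set p : ℝ := ((cycleOccupation κ S x₀ Set.univ)⁻¹).toReal with hp
  have hp0 : 0 ≤ p := ENNReal.toReal_nonneg
  have hpE : (cycleOccupation κ S x₀ Set.univ)⁻¹ = ENNReal.ofReal p := by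
    rw [hp, ENNReal.ofReal_toReal (ENNReal.inv_ne_top.2 cycleOccupation_univ_ne_zero)]
  set u : ℕ → ℝ := fun n => (regenProb κ S x₀ n).toReal with hu
  have hu0 : ∀ n, 0 ≤ u n := fun n => ENNReal.toReal_nonneg
  have hu1 : ∀ n, u n ≤ 1 := fun n =>
    ENNReal.toReal_le_of_le_ofReal zero_le_one (by simpa using regenProb_le_one hS n)
  have huE : ∀ n, regenProb κ S x₀ n = ENNReal.ofReal (u n) := fun n => by
    rw [hu, ENNReal.ofReal_toReal ((regenProb_le_one hS n).trans_lt ENNReal.one_lt_top).ne]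
  have hlim : Tendsto u atTop (𝓝 p) := tendsto_regenProb hS hr hr1 hdec hap
  -- the probability of a visit at time `n - j`, zero when `n < j`
  set v : ℕ → ℕ → ℝ := fun n j => if j ≤ n then u (n - j) else 0 with hv
  have hv0 : ∀ n j, 0 ≤ v n j := fun n j => by
    simp only [hv]; split_ifs <;> simp [hu0]
  have hv1 : ∀ n j, v n j ≤ 1 := fun n j => by
    simp only [hv]; split_ifs <;> simp [hu1]
  set w : ℕ → ℕ → ℝ≥0∞ := fun n j => ENNReal.ofReal |v n j - p| with hw
  have haB : ∀ n B, MeasurableSet B →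
      a n B = ∑' j, ENNReal.ofReal (v n j) * excursion κ S x₀ j B := by
    intro n B hB
    rw [ha, regenStep_iterate_eq_sum, Measure.finsetSum_apply,
      Finset.Nat.sum_antidiagonal_eq_sum_range_succ_mk, ← Finset.sum_range_reflect,
      tsum_eq_sum (s := Finset.range (n + 1))]
    · refine Finset.sum_congr rfl fun j hj => ?_
      have hj' : j ≤ n := Nat.lt_succ_iff.1 (Finset.mem_range.1 hj)
      rw [Measure.smul_apply, smul_eq_mul, huE, hv]
      simp only [if_pos hj', show n + 1 - 1 - j = n - j by omega,
        show n - (n - j) = j by omega]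
    · intro j hj
      have hj' : ¬ j ≤ n := fun h => hj (Finset.mem_range.2 (by omega))
      simp [hv, hj']
  have hπB : ∀ B, MeasurableSet B → π B = ∑' j, ENNReal.ofReal p * excursion κ S x₀ j B := by
    intro B hB
    rw [hπ, Measure.smul_apply, hpE, cycleOccupation_apply hB, smul_eq_mul, ENNReal.tsum_mul_left]
  have hmB : ∀ n B, MeasurableSet B → Measure.sum (fun j => w n j • excursion κ S x₀ j) B =
      ∑' j, w n j * excursion κ S x₀ j B := by
    intro n B hB
    rw [Measure.sum_apply _ hB]; simp
  have htv : ∀ n, ((a n).toSignedMeasure - π.toSignedMeasure).totalVariation Set.univ ≤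
      ∑' j, w n j * excursion κ S x₀ j Set.univ := by
    intro n
    rw [← hmB n _ MeasurableSet.univ]
    refine totalVariation_sub_le_of_le_add (fun B hB => ?_) (fun B hB => ?_)
    · rw [haB n B hB, hπB B hB, hmB n B hB, ← ENNReal.tsum_add]
      refine ENNReal.tsum_le_tsum fun j => ?_
      rw [← add_mul, hw, ← ENNReal.ofReal_add hp0 (abs_nonneg _)]
      gcongr
      linarith [le_abs_self (v n j - p)]
    · rw [haB n B hB, hπB B hB, hmB n B hB, ← ENNReal.tsum_add]
      refine ENNReal.tsum_le_tsum fun j => ?_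
      rw [← add_mul, hw, ← ENNReal.ofReal_add (hv0 n j) (abs_nonneg _)]
      gcongr
      linarith [neg_abs_le (v n j - p)]
  have hw1 : ∀ n j, w n j ≤ ENNReal.ofReal (1 + p) := fun n j => by
    refine ENNReal.ofReal_le_ofReal (abs_le.2 ⟨?_, ?_⟩) <;> linarith [hv0 n j, hv1 n j]
  have hwlim : ∀ j, Tendsto (fun n => w n j) atTop (𝓝 0) := by
    intro j
    have h1 : Tendsto (fun n => v n j) atTop (𝓝 p) := by
      refine Tendsto.congr' ?_ (hlim.comp (tendsto_sub_atTop_nat j))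
      filter_upwards [eventually_ge_atTop j] with n hn
      simp [hv, hn]
    have h2 := (h1.sub_const p).abs
    rw [sub_self, abs_zero] at h2
    simpa using ENNReal.tendsto_ofReal h2
  refine tendsto_of_tendsto_of_tendsto_of_le_of_le tendsto_const_nhds ?_
    (fun _ => zero_le) htv
  simp only [← lintegral_count]
  have hdom := tendsto_lintegral_of_dominated_convergence (μ := Measure.count)
    (F := fun n j => w n j * excursion κ S x₀ j Set.univ) (f := fun _ => 0)
    (fun j => ENNReal.ofReal (1 + p) * excursion κ S x₀ j Set.univ)
    (fun n => measurable_of_countable _) (fun n => ae_of_all _ fun j =>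
      mul_le_mul' (hw1 n j) le_rfl)
    (by
      rw [lintegral_count, ENNReal.tsum_mul_left, ← cycleOccupation_apply MeasurableSet.univ]
      exact ENNReal.mul_ne_top ENNReal.ofReal_ne_top hfin)
    (ae_of_all _ fun j => by
      have := ENNReal.Tendsto.mul_const (hwlim j) (b := excursion κ S x₀ j Set.univ)
        (Or.inr ((excursion_univ_le_one j).trans_lt ENNReal.one_lt_top).ne)
      simpa using this)
  simpa using hdom

end Regeneration

/-! ### Geometric decay of a killed chain -/

section Drift

variable {E : Type*} [MeasurableSpace E] {κ : Kernel E E} {S : Set E}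

theorem lintegral_kernel_pow_succ (κ : Kernel E E) (n : ℕ) (x : E) {g : E → ℝ≥0∞} (hg : Measurable g) :
    ∫⁻ y, g y ∂(κ ^ (n + 1)) x = ∫⁻ y, ∫⁻ z, g z ∂(κ ^ n) y ∂κ x := by
  rw [pow_succ]
  exact Kernel.lintegral_comp _ _ _ hg

theorem lintegral_kernel_pow_succ' (κ : Kernel E E) (n : ℕ) (x : E) {g : E → ℝ≥0∞} (hg : Measurable g) :
    ∫⁻ y, g y ∂(κ ^ (n + 1)) x = ∫⁻ y, ∫⁻ z, g z ∂κ y ∂(κ ^ n) x := by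
  rw [pow_succ']
  exact Kernel.lintegral_comp _ _ _ hg

/-- Killing between the start and the end of a run of `n` steps only loses mass. -/
theorem lintegral_killedStep_iterate_le (n : ℕ) (ν : Measure E)
    {g : E → ℝ≥0∞} (hg : Measurable g) :
    ∫⁻ y, g y ∂(killedStep κ S)^[n + 1] ν ≤ ∫⁻ x in Sᶜ, ∫⁻ y, g y ∂(κ ^ (n + 1)) x ∂ν := by
  induction n generalizing g with
  | zero => simp [lintegral_killedStep ν hg]
  | succ n ih =>
    rw [Function.iterate_succ_apply', lintegral_killedStep _ hg]
    refine (setLIntegral_le_lintegral _ _).trans ((ih hg.lintegral_kernel).trans_eq ?_)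
    simp_rw [lintegral_kernel_pow_succ' κ (n + 1) _ hg]

/-- A Lyapunov function contracted by `N` steps of the chain off `S` gives a geometric decay of the
chain killed in `S`. -/
theorem killedStep_iterate_univ_le_geometric [IsMarkovKernel κ] (hS : MeasurableSet S) {N : ℕ}
    {W : E → ℝ≥0∞} (hW : Measurable W) (hW1 : ∀ x, 1 ≤ W x) {ρ : ℝ≥0∞}
    (hdrift : ∀ x, ∫⁻ y in Sᶜ, W y ∂(κ ^ (N + 1)) x ≤ ρ * W x) (ν : Measure E) (k : ℕ) :
    (killedStep κ S)^[(N + 1) * k + 1] ν Set.univ ≤ ρ ^ k * ∫⁻ x, W x ∂ν := by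
  have hstep : ∀ ν : Measure E, ∫⁻ y in Sᶜ, W y ∂(killedStep κ S)^[N + 1] ν ≤
      ρ * ∫⁻ x in Sᶜ, W x ∂ν := by
    intro ν
    rw [← lintegral_indicator hS.compl, ← lintegral_const_mul _ hW]
    refine (lintegral_killedStep_iterate_le N ν (hW.indicator hS.compl)).trans ?_
    refine lintegral_mono fun x => ?_
    rw [lintegral_indicator hS.compl]
    exact hdrift x
  have hiter : ∀ k, ∫⁻ y in Sᶜ, W y ∂(killedStep κ S)^[(N + 1) * k] ν ≤
      ρ ^ k * ∫⁻ x in Sᶜ, W x ∂ν := by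
    intro k
    induction k with
    | zero => simp
    | succ k ih =>
      rw [mul_add, mul_one, add_comm, Function.iterate_add_apply, pow_succ', mul_assoc]
      exact (hstep _).trans (mul_le_mul' le_rfl ih)
  rw [Function.iterate_succ_apply', killedStep_univ, ← setLIntegral_one]
  exact (lintegral_mono fun x => hW1 x).trans
    ((hiter k).trans (mul_le_mul' le_rfl (setLIntegral_le_lintegral _ _)))

theorem antitone_killedStep_iterate_univ [IsMarkovKernel κ] (ν : Measure E) :
    Antitone fun n => (killedStep κ S)^[n] ν Set.univ := by
  refine antitone_nat_of_succ_le fun n => ?_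
  rw [Function.iterate_succ_apply', killedStep_univ]
  exact measure_mono (Set.subset_univ _)

theorem tendsto_killedStep_iterate_univ_of_lintegral_ne_top [IsMarkovKernel κ]
    (hS : MeasurableSet S) {N : ℕ} {W : E → ℝ≥0∞} (hW : Measurable W) (hW1 : ∀ x, 1 ≤ W x)
    {ρ : ℝ≥0∞} (hρ : ρ < 1) (hdrift : ∀ x, ∫⁻ y in Sᶜ, W y ∂(κ ^ (N + 1)) x ≤ ρ * W x)
    {ν : Measure E} (hν : ∫⁻ x, W x ∂ν ≠ ⊤) :
    Tendsto (fun n => (killedStep κ S)^[n] ν Set.univ) atTop (𝓝 0) := by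
  have h1 : Tendsto (fun k => ρ ^ k * ∫⁻ x, W x ∂ν) atTop (𝓝 0) := by
    simpa using ENNReal.Tendsto.mul_const (ENNReal.tendsto_pow_atTop_nhds_zero_of_lt_one hρ)
      (Or.inr hν)
  rw [ENNReal.tendsto_atTop_zero] at h1 ⊢
  intro ε hε
  obtain ⟨k, hk⟩ := h1 ε hε
  exact ⟨(N + 1) * k + 1, fun n hn => (antitone_killedStep_iterate_univ ν hn).trans
    ((killedStep_iterate_univ_le_geometric hS hW hW1 hdrift ν k).trans (hk k le_rfl))⟩

/-- Under the contraction hypothesis the killed chain dies out from every finite initial measure,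
by truncation of the initial measure to sublevel sets of `W`. -/
theorem tendsto_killedStep_iterate_univ [IsMarkovKernel κ] (hS : MeasurableSet S) {N : ℕ}
    {W : E → ℝ≥0∞} (hW : Measurable W) (hW1 : ∀ x, 1 ≤ W x) (hWtop : ∀ x, W x ≠ ⊤) {ρ : ℝ≥0∞}
    (hρ : ρ < 1) (hdrift : ∀ x, ∫⁻ y in Sᶜ, W y ∂(κ ^ (N + 1)) x ≤ ρ * W x)
    (ν : Measure E) [IsFiniteMeasure ν] :
    Tendsto (fun n => (killedStep κ S)^[n] ν Set.univ) atTop (𝓝 0) := by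
  have hTm : ∀ k : ℕ, MeasurableSet {x | W x ≤ k} := fun k => hW measurableSet_Iic
  have htail : Tendsto (fun k : ℕ => ν {x | W x ≤ k}ᶜ) atTop (𝓝 0) := by
    have h1 := tendsto_measure_iInter_atTop (μ := ν) (s := fun k : ℕ => {x | W x ≤ k}ᶜ)
      (fun k => (hTm k).compl.nullMeasurableSet)
      (fun i j hij => Set.compl_subset_compl.2 fun x hx =>
        le_trans (Set.mem_ofPred.1 hx) (by exact_mod_cast hij))
      ⟨0, measure_ne_top _ _⟩
    have h2 : ⋂ k : ℕ, {x | W x ≤ k}ᶜ = ∅ := by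
      rw [Set.eq_empty_iff_forall_notMem]
      intro x hx
      obtain ⟨k, hk⟩ := ENNReal.exists_nat_gt (hWtop x)
      exact Set.mem_iInter.1 hx k hk.le
    rwa [h2, measure_empty] at h1
  rw [ENNReal.tendsto_atTop_zero]
  intro ε hε
  have hε2 : 0 < ε / 2 := ENNReal.half_pos hε.ne'
  obtain ⟨k, hk⟩ := ENNReal.tendsto_atTop_zero.1 htail _ hε2
  have hint : ∫⁻ x, W x ∂ν.restrict {x | W x ≤ k} ≠ ⊤ := by
    refine ne_top_of_le_ne_top (ENNReal.mul_ne_top (ENNReal.natCast_ne_top k)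
      (measure_ne_top ν Set.univ)) ?_
    calc ∫⁻ x in {x | W x ≤ k}, W x ∂ν ≤ ∫⁻ x in {x | W x ≤ k}, (k : ℝ≥0∞) ∂ν :=
          setLIntegral_mono measurable_const fun x hx => hx
      _ = k * ν {x | W x ≤ k} := by rw [setLIntegral_const]
      _ ≤ k * ν Set.univ := by gcongr; exact Set.subset_univ _
  obtain ⟨n₀, hn₀⟩ := ENNReal.tendsto_atTop_zero.1
    (tendsto_killedStep_iterate_univ_of_lintegral_ne_top hS hW hW1 hρ hdrift hint) _ hε2
  refine ⟨n₀, fun n hn => ?_⟩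
  conv_lhs => rw [← Measure.restrict_add_restrict_compl (μ := ν) (hTm k)]
  rw [iterate_map_add, Measure.add_apply, ← ENNReal.add_halves ε]
  refine add_le_add (hn₀ n hn) ((killedStep_iterate_univ_le _ n).trans ?_)
  rw [Measure.restrict_apply_univ]
  exact hk k le_rfl

/-- Geometric decay along an arithmetic progression of an antitone sequence is geometric decay. -/
theorem exists_le_mul_pow_of_antitone {M : ℕ → ℝ} (hM : Antitone M) {N : ℕ} {C ρ : ℝ}
    (hρ : 0 < ρ) (hρ1 : ρ < 1) (h : ∀ k, M ((N + 1) * k + 1) ≤ C * ρ ^ k) :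
    ∃ C' r : ℝ, 0 < r ∧ r < 1 ∧ ∀ n, M n ≤ C' * r ^ n := by
  set r : ℝ := ρ ^ ((N + 1 : ℕ) : ℝ)⁻¹ with hr
  have hr0 : 0 < r := Real.rpow_pos_of_pos hρ _
  have hr1 : r < 1 := Real.rpow_lt_one hρ.le hρ1 (by positivity)
  have hrN : r ^ (N + 1) = ρ := Real.rpow_inv_natCast_pow hρ.le (by omega)
  set D : ℝ := max (max C (M 0)) 0
  have hD : 0 ≤ D := le_max_right _ _
  refine ⟨D / r ^ (N + 1), r, hr0, hr1, fun n => ?_⟩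
  rw [div_mul_eq_mul_div, le_div_iff₀ (by positivity)]
  rcases n with _ | n
  · rw [pow_zero, mul_one]
    exact (mul_le_mul_of_nonneg_right ((le_max_right _ _).trans (le_max_left _ _))
      (by positivity)).trans (mul_le_of_le_one_right hD (pow_le_one₀ hr0.le hr1.le))
  · set k := n / (N + 1)
    have h1 : (N + 1) * k ≤ n := Nat.mul_div_le _ _
    have h2 : n < (N + 1) * k + (N + 1) := by
      have := Nat.lt_mul_div_succ n (Nat.succ_pos N)
      rwa [mul_add, mul_one] at this
    have h3 : M (n + 1) ≤ D * ρ ^ k :=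
      (hM (by omega)).trans ((h k).trans (mul_le_mul_of_nonneg_right
        ((le_max_left _ _).trans (le_max_left _ _)) (by positivity)))
    calc M (n + 1) * r ^ (N + 1) ≤ D * ρ ^ k * r ^ (N + 1) := by gcongr
      _ = D * r ^ ((N + 1) * k + (N + 1)) := by rw [← hrN]; ring
      _ ≤ D * r ^ (n + 1) :=
        mul_le_mul_of_nonneg_left (pow_le_pow_of_le_one hr0.le hr1.le (by omega)) hD

theorem exists_geometric_killedStep_iterate [IsMarkovKernel κ] (hS : MeasurableSet S) {N : ℕ}
    {W : E → ℝ≥0∞} (hW : Measurable W) (hW1 : ∀ x, 1 ≤ W x) {ρ : ℝ} (hρ0 : 0 < ρ)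
    (hρ : ρ < 1) (hdrift : ∀ x, ∫⁻ y in Sᶜ, W y ∂(κ ^ (N + 1)) x ≤ ENNReal.ofReal ρ * W x)
    {ν : Measure E} [IsFiniteMeasure ν] (hν : ∫⁻ x, W x ∂ν ≠ ⊤) :
    ∃ C r : ℝ, 0 < r ∧ r < 1 ∧
      ∀ n, ((killedStep κ S)^[n] ν Set.univ).toReal ≤ C * r ^ n := by
  have hfin : ∀ n, (killedStep κ S)^[n] ν Set.univ ≠ ⊤ := fun n =>
    ((killedStep_iterate_univ_le ν n).trans_lt (measure_lt_top ν _)).ne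
  refine exists_le_mul_pow_of_antitone (C := (∫⁻ x, W x ∂ν).toReal) (N := N)
    (fun m n hmn => ENNReal.toReal_mono (hfin m) (antitone_killedStep_iterate_univ ν hmn))
    hρ0 hρ fun k => ?_
  have h1 := ENNReal.toReal_mono (ENNReal.mul_ne_top (by finiteness) hν)
    (killedStep_iterate_univ_le_geometric hS hW hW1 hdrift ν k)
  rwa [ENNReal.toReal_mul, ENNReal.toReal_pow, ENNReal.toReal_ofReal hρ0.le,
    mul_comm (ρ ^ k)] at h1

/-- A linear drift condition off `S` bounds the integral of `V` against the occupation measure of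
a cycle. -/
theorem lintegral_cycleOccupation_lt_top [IsMarkovKernel κ] {x₀ : E}
    {V : E → ℝ≥0∞} (hV : Measurable V) {l b : ℝ≥0∞} (hl : l < 1) (hb : b ≠ ⊤)
    (hdrift : ∀ x, ∫⁻ y, V y ∂κ x ≤ l * V x + b) (hx₀ : V x₀ ≠ ⊤)
    (hfin : cycleOccupation κ S x₀ Set.univ ≠ ⊤) :
    ∫⁻ x, V x ∂cycleOccupation κ S x₀ < ⊤ := by
  set s : ℕ → ℝ≥0∞ := fun n => ∫⁻ x, V x ∂excursion κ S x₀ n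
  have hltop : l ≠ ⊤ := (hl.trans ENNReal.one_lt_top).ne
  have hs0 : s 0 ≠ ⊤ :=
    ne_top_of_le_ne_top (ENNReal.add_ne_top.2 ⟨ENNReal.mul_ne_top hltop hx₀, hb⟩) (hdrift x₀)
  have hs : ∀ n, s (n + 1) ≤ l * s n + b * excursion κ S x₀ n Set.univ := by
    intro n
    change ∫⁻ x, V x ∂excursion κ S x₀ (n + 1) ≤ _
    rw [excursion_succ, lintegral_killedStep _ hV]
    refine (setLIntegral_le_lintegral _ _).trans ((lintegral_mono hdrift).trans_eq ?_)
    rw [lintegral_add_right _ measurable_const, lintegral_const_mul _ hV, lintegral_const]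
  have hsfin : ∀ n, s n ≠ ⊤ := by
    intro n
    induction n with
    | zero => exact hs0
    | succ n ih =>
      exact ne_top_of_le_ne_top (ENNReal.add_ne_top.2 ⟨ENNReal.mul_ne_top hltop ih,
        ENNReal.mul_ne_top hb ((excursion_univ_le_one n).trans_lt ENNReal.one_lt_top).ne⟩) (hs n)
  rw [cycleOccupation_apply MeasurableSet.univ] at hfin
  set D : ℝ≥0∞ := s 0 + b * ∑' n, excursion κ S x₀ n Set.univ
  have hD : D ≠ ⊤ := ENNReal.add_ne_top.2 ⟨hs0, ENNReal.mul_ne_top hb hfin⟩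
  have hpart : ∀ n, ∑ j ∈ Finset.range n, s j ≤ D / (1 - l) := by
    intro n
    have hT : ∑ j ∈ Finset.range n, s j ≠ ⊤ := ENNReal.sum_ne_top.2 fun j _ => hsfin j
    have h1 : ∑ j ∈ Finset.range n, s j ≤ D + l * ∑ j ∈ Finset.range n, s j := by
      have hmono : ∑ j ∈ Finset.range n, s j ≤ ∑ j ∈ Finset.range (n + 1), s j :=
        Finset.sum_le_sum_of_subset (Finset.range_subset_range.2 n.le_succ)
      refine hmono.trans ?_
      rw [Finset.sum_range_succ', Finset.mul_sum]
      calc ∑ k ∈ Finset.range n, s (k + 1) + s 0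
          ≤ ∑ k ∈ Finset.range n, (l * s k + b * excursion κ S x₀ k Set.univ) + s 0 := by
            gcongr with k; exact hs k
        _ = s 0 + b * ∑ k ∈ Finset.range n, excursion κ S x₀ k Set.univ +
            ∑ k ∈ Finset.range n, l * s k := by
            rw [Finset.sum_add_distrib, Finset.mul_sum]; ring
        _ ≤ _ := by
            exact add_le_add (add_le_add le_rfl (mul_le_mul' le_rfl (ENNReal.sum_le_tsum _))) le_rfl
    rw [ENNReal.le_div_iff_mul_le (Or.inl (tsub_pos_of_lt hl).ne')
      (Or.inl (by finiteness)), mul_comm, ENNReal.sub_mul (fun _ _ => hT), one_mul]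
    exact tsub_le_iff_right.2 h1
  rw [cycleOccupation, lintegral_sum_measure]
  refine lt_of_le_of_lt (le_of_tendsto' (ENNReal.tendsto_nat_tsum s) hpart)
    (ENNReal.div_lt_top hD (tsub_pos_of_lt hl).ne')

end Drift

section FosterLyapunov

variable {E : Type*} [MeasurableSpace E] {κ : Kernel E E} {S : Set E}

theorem kernel_pow_apply_univ [IsMarkovKernel κ] (n : ℕ) (x : E) : (κ ^ n) x Set.univ = 1 := by
  induction n with
  | zero =>
    rw [pow_zero, show (1 : Kernel E E) = Kernel.id from rfl, Kernel.id_apply, measure_univ]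
  | succ n ih =>
    have h := lintegral_kernel_pow_succ' κ n x (g := fun _ => 1) measurable_const
    simpa [ih] using h

theorem lintegral_kernel_pow_le_of_drift [IsMarkovKernel κ] {V : E → NNReal} (hV : Measurable V)
    {l b B : NNReal} (hB : l * B + b ≤ B) (hdrift : ∀ x, ∫⁻ y, V y ∂κ x ≤ (l * V x + b : NNReal))
    (n : ℕ) (x : E) : ∫⁻ y, V y ∂(κ ^ n) x ≤ (l ^ n * V x + B : NNReal) := by
  induction n with
  | zero =>
    rw [pow_zero, show (1 : Kernel E E) = Kernel.id from rfl, Kernel.id_apply,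
      lintegral_dirac' _ hV.coe_nnreal_ennreal]
    simp
  | succ n ih =>
    rw [lintegral_kernel_pow_succ' _ _ _ hV.coe_nnreal_ennreal]
    calc ∫⁻ y, ∫⁻ z, V z ∂κ y ∂(κ ^ n) x ≤ ∫⁻ y, l * (V y : ℝ≥0∞) + b ∂(κ ^ n) x :=
          lintegral_mono fun y => (hdrift y).trans_eq (by push_cast; rfl)
      _ = l * ∫⁻ y, V y ∂(κ ^ n) x + b := by
          rw [lintegral_add_right _ measurable_const,
            lintegral_const_mul _ hV.coe_nnreal_ennreal, lintegral_const, kernel_pow_apply_univ, mul_one]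
      _ ≤ l * (l ^ n * V x + B : NNReal) + b :=
          add_le_add (mul_le_mul' le_rfl ih) le_rfl
      _ ≤ _ := by
          norm_cast
          calc l * (l ^ n * V x + B) + b = l ^ (n + 1) * V x + (l * B + b) := by ring
            _ ≤ _ := by gcongr

/-- The Foster–Lyapunov criterion: a drift towards a sublevel set of `V`, from which `S` is reached
with a probability bounded below, makes `1 + ε V` a contracted function off `S`. -/
theorem exists_contraction_of_drift [IsMarkovKernel κ] (hS : MeasurableSet S) {V : E → NNReal}
    (hV : Measurable V) {l b : NNReal} (hl : l < 1)
    (hdrift : ∀ x, ∫⁻ y, V y ∂κ x ≤ (l * V x + b : NNReal))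
    (hreach : ∀ R : NNReal, ∃ N : ℕ, ∃ δ : NNReal, 0 < δ ∧
      ∀ x, V x ≤ R → δ ≤ (κ ^ (N + 1)) x S) :
    ∃ N : ℕ, ∃ ε : NNReal, ∃ ρ : ℝ, 0 < ρ ∧ ρ < 1 ∧ ∀ x,
      ∫⁻ y in Sᶜ, (1 + ε * V y : NNReal) ∂(κ ^ (N + 1)) x ≤
        ENNReal.ofReal ρ * (1 + ε * V x : NNReal) := by
  have hl' : (l : ℝ) < 1 := hl
  set B : NNReal := b / (1 - l) with hBdef
  have h1l : ((1 - l : NNReal) : ℝ) = 1 - l := NNReal.coe_sub hl.le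
  have hB : (l : ℝ) * B + b = B := by
    have h : (1 - (l : ℝ)) ≠ 0 := by linarith
    rw [hBdef, NNReal.coe_div, h1l]
    field_simp
    ring
  -- Above the level `R` the drift beats both `B` and the defect `1 - ρ` of the constant.
  set R : NNReal := 4 * B / (1 - l) + 1 with hRdef
  have hR : (1 - (l : ℝ)) * R = 4 * B + (1 - l) := by
    have h : (1 - (l : ℝ)) ≠ 0 := by linarith
    rw [hRdef, NNReal.coe_add, NNReal.coe_div, h1l]
    push_cast
    field_simp
  obtain ⟨N, δ₀, hδ₀, hreach⟩ := hreach R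
  set δ : NNReal := min δ₀ 1
  have hδ : (0 : ℝ) < δ := NNReal.coe_pos.2 (lt_min hδ₀ one_pos)
  have hδ1 : δ ≤ 1 := min_le_right _ _
  have hδ1' : (δ : ℝ) ≤ 1 := hδ1
  -- `ε` is so small that `ε B` costs at most half of the gain `δ` below the level `R`.
  set ε : NNReal := δ / (2 * (B + 1)) with hεdef
  have hε : (ε : ℝ) * (B + 1) = δ / 2 := by
    rw [hεdef, NNReal.coe_div]
    push_cast
    field_simp
  have hε0 : (0 : ℝ) < ε := by
    rw [hεdef, NNReal.coe_div]; push_cast; positivity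
  -- The first bound serves below the level `R`, the third above it, and the second, which lies
  -- between `l` and `1`, absorbs the drift term on both sides.
  set ρ : ℝ := max (1 - δ / 2) (max ((1 + l) / 2) (1 - ε * (1 - l) / 2)) with hρdef
  have hρ1 : 1 - δ / 2 ≤ ρ := le_max_left _ _
  have hρ2 : (1 + l) / 2 ≤ ρ := (le_max_left _ _).trans (le_max_right _ _)
  have hρ3 : 1 - ε * (1 - l) / 2 ≤ ρ := (le_max_right _ _).trans (le_max_right _ _)
  refine ⟨N, ε, ρ, by linarith [l.coe_nonneg], ?_, fun x => ?_⟩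
  · refine max_lt (by linarith) (max_lt (by linarith) ?_)
    have : 0 < (ε : ℝ) * (1 - l) := mul_pos hε0 (by linarith)
    linarith
  have hVle : ∫⁻ y in Sᶜ, (ε * V y : NNReal) ∂(κ ^ (N + 1)) x ≤
      (ε * (l * V x + B) : NNReal) := by
    simp only [ENNReal.coe_mul ε]
    rw [lintegral_const_mul _ hV.coe_nnreal_ennreal]
    refine mul_le_mul' le_rfl ((setLIntegral_le_lintegral _ _).trans
      ((lintegral_kernel_pow_le_of_drift hV (b := b) (B := B) ?_ hdrift (N + 1) x).trans ?_))
    · rw [← NNReal.coe_le_coe]; push_cast; exact hB.le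
    · refine ENNReal.coe_le_coe.2 (add_le_add (mul_le_mul' ?_ le_rfl) le_rfl)
      rw [pow_succ]
      exact mul_le_of_le_one_left' (pow_le_one₀ zero_le hl.le)
  have hsplit : ∫⁻ y in Sᶜ, (1 + ε * V y : NNReal) ∂(κ ^ (N + 1)) x ≤
      (κ ^ (N + 1)) x Sᶜ + (ε * (l * V x + B) : NNReal) := by
    simp only [ENNReal.coe_add, ENNReal.coe_one]
    rw [lintegral_add_left measurable_const, setLIntegral_one]
    exact add_le_add le_rfl (by simpa only [ENNReal.coe_add] using hVle)
  have huniv : (κ ^ (N + 1)) x Set.univ = 1 := kernel_pow_apply_univ (N + 1) x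
  refine hsplit.trans ?_
  rw [ENNReal.ofReal, ← ENNReal.coe_mul]
  have hρc : (ρ.toNNReal : ℝ) = ρ := Real.coe_toNNReal _ (by linarith [l.coe_nonneg])
  by_cases hx : V x ≤ R
  · have h1 : (κ ^ (N + 1)) x Sᶜ ≤ (1 - δ : NNReal) := by
      have h2 : (δ : ℝ≥0∞) ≤ (κ ^ (N + 1)) x S :=
        (ENNReal.coe_le_coe.2 (min_le_left _ _)).trans (hreach x hx)
      have h3 := measure_add_measure_compl (μ := (κ ^ (N + 1)) x) hS
      rw [huniv] at h3
      rw [ENNReal.coe_sub, ENNReal.coe_one]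
      refine ENNReal.le_sub_of_add_le_left ENNReal.coe_ne_top ?_
      exact (add_le_add h2 le_rfl).trans_eq h3
    refine (add_le_add h1 le_rfl).trans ?_
    norm_cast
    rw [← NNReal.coe_le_coe]
    push_cast [NNReal.coe_sub hδ1, hρc]
    have h4 : (l : ℝ) * (ε * V x) ≤ ρ * (ε * V x) :=
      mul_le_mul_of_nonneg_right (by linarith) (by positivity)
    nlinarith
  · have hx' : (R : ℝ) ≤ V x := by exact_mod_cast (not_le.1 hx).le
    refine (add_le_add ((measure_mono (Set.subset_univ _)).trans_eq huniv) le_rfl).trans ?_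
    norm_cast
    rw [← NNReal.coe_le_coe]
    push_cast [hρc]
    have h4 : ((1 - l) / 2) * (ε * V x) ≤ (ρ - l) * (ε * V x) :=
      mul_le_mul_of_nonneg_right (by linarith) (by positivity)
    have h5 : ((1 - (l : ℝ)) / 2 * ε) * R ≤ ((1 - (l : ℝ)) / 2 * ε) * V x :=
      mul_le_mul_of_nonneg_left hx' (mul_nonneg (by linarith) hε0.le)
    have h6 : ((1 - (l : ℝ)) / 2 * ε) * R = 2 * ε * B + ε * (1 - l) / 2 := by
      linear_combination (ε : ℝ) / 2 * hR
    have h7 : 0 ≤ (ε : ℝ) * B := by positivity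
    linarith

end FosterLyapunov

/-! ### The autoregression kernel: drift and steering -/

section Autoregression

variable {d : ℕ}

/-- One step of the autoregression: `(x, a, s) ↦ a x + β s`. -/
noncomputable def arStep (β : ℝ)
    (p : EuclideanSpace ℝ (Fin d) × ℝ × EuclideanSpace ℝ (Fin d)) : EuclideanSpace ℝ (Fin d) :=
  p.2.1 • p.1 + β • p.2.2

theorem measurable_arStep (β : ℝ) : Measurable (arStep (d := d) β) := by
  unfold arStep; fun_prop

/-- The transition kernel of the autoregression `x ↦ α x + β ξ`. -/
noncomputable def arKernel (β : ℝ) (μα : Measure ℝ) (μξ : Measure (EuclideanSpace ℝ (Fin d)))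
    [SFinite μα] [SFinite μξ] :
    Kernel (EuclideanSpace ℝ (Fin d)) (EuclideanSpace ℝ (Fin d)) where
  toFun x := ((μα.prod μξ).map (Prod.mk x)).map (arStep β)
  measurable' := (Measure.measurable_map _ (measurable_arStep β)).comp Measurable.map_prodMk_left

variable {β : ℝ} {μα : Measure ℝ} {μξ : Measure (EuclideanSpace ℝ (Fin d))}
  [IsProbabilityMeasure μα] [IsProbabilityMeasure μξ]

theorem arKernel_eq_map (x : EuclideanSpace ℝ (Fin d)) :
    arKernel β μα μξ x = (μα.prod μξ).map fun q => arStep β (x, q) := by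
  change ((μα.prod μξ).map (Prod.mk x)).map (arStep β) = _
  rw [Measure.map_map (measurable_arStep β) measurable_prodMk_left]
  rfl

theorem measurable_arStep_mk (β : ℝ) (x : EuclideanSpace ℝ (Fin d)) :
    Measurable fun q => arStep β (x, q) :=
  (measurable_arStep β).comp measurable_prodMk_left

instance : IsMarkovKernel (arKernel β μα μξ) :=
  ⟨fun x => by
    rw [arKernel_eq_map]
    exact Measure.isProbabilityMeasure_map (measurable_arStep_mk β x).aemeasurable⟩

theorem lintegral_arKernel (x : EuclideanSpace ℝ (Fin d)) {g : EuclideanSpace ℝ (Fin d) → ℝ≥0∞}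
    (hg : Measurable g) :
    ∫⁻ y, g y ∂arKernel β μα μξ x = ∫⁻ q, g (q.1 • x + β • q.2) ∂μα.prod μξ := by
  rw [arKernel_eq_map, lintegral_map hg (measurable_arStep_mk β x)]
  rfl

theorem arKernel_comp (ν : Measure (EuclideanSpace ℝ (Fin d))) [SFinite ν] :
    arKernel β μα μξ ∘ₘ ν = (ν.prod (μα.prod μξ)).map (arStep β) := by
  refine Measure.ext_of_lintegral _ fun g hg => ?_
  rw [Measure.lintegral_bind (arKernel β μα μξ).aemeasurable hg.aemeasurable,
    lintegral_map hg (measurable_arStep β),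
    lintegral_prod (fun p => g (arStep β p)) (hg.comp (measurable_arStep β)).aemeasurable]
  simp_rw [lintegral_arKernel _ hg]
  rfl

/-- Contraction of the first moment in mean. -/
theorem lintegral_nnnorm_arKernel_le {l b : NNReal}
    (hl : ∫⁻ a, ‖a‖ₑ ∂μα = l) (hb : ‖β‖ₑ * ∫⁻ s, ‖s‖ₑ ∂μξ = b)
    (x : EuclideanSpace ℝ (Fin d)) :
    ∫⁻ y, ‖y‖₊ ∂arKernel β μα μξ x ≤ (l * ‖x‖₊ + b : NNReal) := by
  rw [lintegral_arKernel x measurable_nnnorm.coe_nnreal_ennreal]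
  push_cast
  rw [← hl, ← hb]
  calc ∫⁻ q, ‖q.1 • x + β • q.2‖ₑ ∂μα.prod μξ
      ≤ ∫⁻ q, ‖q.1‖ₑ * ‖x‖ₑ + ‖β‖ₑ * ‖q.2‖ₑ ∂μα.prod μξ := by
        refine lintegral_mono fun q => (enorm_add_le _ _).trans_eq ?_
        rw [enorm_smul, enorm_smul]
    _ = (∫⁻ q, ‖q.1‖ₑ ∂μα.prod μξ) * ‖x‖ₑ + ‖β‖ₑ * ∫⁻ q, ‖q.2‖ₑ ∂μα.prod μξ := by
        rw [lintegral_add_left (by fun_prop), lintegral_mul_const _ (by fun_prop),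
          lintegral_const_mul _ (by fun_prop)]
    _ = _ := by
        rw [lintegral_prod _ (by fun_prop), lintegral_prod _ (by fun_prop)]
        simp
        rfl

/-- The autoregression started anywhere in a bounded set is, after `n` steps, close to
`a ^ n • x + c` with a probability bounded below. -/
def ReachesOffset (β : ℝ) (μα : Measure ℝ) (μξ : Measure (EuclideanSpace ℝ (Fin d)))
    [SFinite μα] [SFinite μξ] (a : ℝ) (n : ℕ) (c : EuclideanSpace ℝ (Fin d)) : Prop :=
  ∀ R ε : ℝ, 0 < ε → ∃ δ : NNReal, 0 < δ ∧ ∀ x, ‖x‖ ≤ R →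
    δ ≤ (arKernel β μα μξ ^ n) x (Metric.ball (a ^ n • x + c) ε)

theorem reachesOffset_zero (a : ℝ) : ReachesOffset β μα μξ a 0 0 := by
  refine fun R ε hε => ⟨1, one_pos, fun x _ => ?_⟩
  rw [pow_zero, show (1 : Kernel _ (EuclideanSpace ℝ (Fin d))) = Kernel.id from rfl,
    Kernel.id_apply, Measure.dirac_apply' _ Metric.isOpen_ball.measurableSet]
  simp [hε]

theorem ReachesOffset.succ {a : ℝ} (ha : ∀ u ∈ 𝓝 a, 0 < μα u) {n : ℕ}
    {c v : EuclideanSpace ℝ (Fin d)} (hv : v ∈ μξ.support) (h : ReachesOffset β μα μξ a n c) :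
    ReachesOffset β μα μξ a (n + 1) (a • c + β • v) := by
  intro R ε hε
  -- `η K` bounds the error of one step when `x`, `α` and `ξ` are `η`-close to their targets.
  set K : ℝ := |a| + 1 + (|a| ^ n * |R| + ‖c‖) + |β| with hK
  have hK0 : 0 < K := by positivity
  set η : ℝ := min 1 (ε / (2 * K)) with hη
  have hη0 : 0 < η := lt_min one_pos (by positivity)
  have hη1 : η ≤ 1 := min_le_left _ _
  have hηK : η * K < ε := by
    have : η * K ≤ ε / (2 * K) * K := mul_le_mul_of_nonneg_right (min_le_right _ _) hK0.le
    have h2 : ε / (2 * K) * K = ε / 2 := by field_simp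
    linarith
  obtain ⟨δ, hδ, hn⟩ := h R η hη0
  have hp : 0 < (μα.prod μξ) (Metric.ball a η ×ˢ Metric.ball v η) := by
    rw [Measure.prod_prod]
    exact ENNReal.mul_pos (ha _ (Metric.ball_mem_nhds _ hη0)).ne'
      ((Measure.mem_support_iff_forall _).1 hv _ (Metric.ball_mem_nhds _ hη0)).ne'
  have hptop : (μα.prod μξ) (Metric.ball a η ×ˢ Metric.ball v η) ≠ ⊤ := measure_ne_top _ _
  refine ⟨(μα.prod μξ (Metric.ball a η ×ˢ Metric.ball v η)).toNNReal * δ,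
    mul_pos (ENNReal.toNNReal_pos hp.ne' hptop) hδ, fun x hx => ?_⟩
  rw [ENNReal.coe_mul, ENNReal.coe_toNNReal hptop]
  set q : EuclideanSpace ℝ (Fin d) := a ^ n • x + c with hq
  have hqn : ‖q‖ ≤ |a| ^ n * |R| + ‖c‖ := by
    refine (norm_add_le _ _).trans (add_le_add ?_ le_rfl)
    rw [norm_smul, norm_pow, Real.norm_eq_abs]
    exact mul_le_mul_of_nonneg_left (hx.trans (le_abs_self R)) (by positivity)
  have htarget : a ^ (n + 1) • x + (a • c + β • v) = a • q + β • v := by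
    rw [hq, smul_add, smul_smul, pow_succ', add_assoc]
  rw [htarget, ← lintegral_indicator_one Metric.isOpen_ball.measurableSet,
    lintegral_kernel_pow_succ' _ _ _ (measurable_one.indicator Metric.isOpen_ball.measurableSet)]
  simp_rw [lintegral_indicator_one (Metric.isOpen_ball (x := a • q + β • v)
    (ε := ε)).measurableSet]
  have hstep : ∀ y ∈ Metric.ball q η,
      (μα.prod μξ) (Metric.ball a η ×ˢ Metric.ball v η) ≤
        arKernel β μα μξ y (Metric.ball (a • q + β • v) ε) := by
    intro y hy
    rw [arKernel_eq_map, Measure.map_apply (measurable_arStep_mk β y)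
      Metric.isOpen_ball.measurableSet]
    refine measure_mono fun s hs => ?_
    rw [mem_ball_iff_norm] at hy
    obtain ⟨hs1, hs2⟩ := hs
    rw [mem_ball_iff_norm, Real.norm_eq_abs] at hs1
    rw [mem_ball_iff_norm] at hs2
    rw [Set.mem_preimage, mem_ball_iff_norm, arStep]
    have h1 : s.1 • y + β • s.2 - (a • q + β • v) =
        s.1 • (y - q) + (s.1 - a) • q + β • (s.2 - v) := by
      simp only [smul_sub, sub_smul]; abel
    have h2 : |s.1| ≤ |a| + 1 := by
      have := abs_sub_abs_le_abs_sub s.1 a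
      linarith
    simp only [h1]
    calc ‖s.1 • (y - q) + (s.1 - a) • q + β • (s.2 - v)‖
        ≤ |s.1| * ‖y - q‖ + |s.1 - a| * ‖q‖ + |β| * ‖s.2 - v‖ := by
          refine (norm_add₃_le).trans_eq ?_
          simp only [norm_smul, Real.norm_eq_abs]
      _ ≤ (|a| + 1) * η + η * (|a| ^ n * |R| + ‖c‖) + |β| * η := by gcongr
      _ = η * K := by rw [hK]; ring
      _ < ε := hηK
  calc (μα.prod μξ) (Metric.ball a η ×ˢ Metric.ball v η) * δ
      ≤ (μα.prod μξ) (Metric.ball a η ×ˢ Metric.ball v η) *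
          (arKernel β μα μξ ^ n) x (Metric.ball q η) := mul_le_mul' le_rfl (hn x hx)
    _ = ∫⁻ _ in Metric.ball q η, (μα.prod μξ) (Metric.ball a η ×ˢ Metric.ball v η)
          ∂(arKernel β μα μξ ^ n) x := by rw [setLIntegral_const]
    _ ≤ ∫⁻ y in Metric.ball q η, arKernel β μα μξ y (Metric.ball (a • q + β • v) ε)
          ∂(arKernel β μα μξ ^ n) x :=
        setLIntegral_mono' Metric.isOpen_ball.measurableSet hstep
    _ ≤ _ := setLIntegral_le_lintegral _ _

/-- Expansion of a point of a simplex in the base `a`. If `1 - a ≤ 1 / (d + 1)` then one of the at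
most `d + 1` barycentric weights of a point `y` is at least `1 - a`, so that
`y = (1 - a) z i + a y'` with `y'` in the same simplex. -/
theorem exists_reachesOffset_of_mem_simplex {a : ℝ} (ha0 : 0 < a)
    (ha : ∀ u ∈ 𝓝 a, 0 < μα u) {ι : Type*} [Fintype ι] {z : ι → EuclideanSpace ℝ (Fin d)}
    (hz : ∀ i, z i ∈ μξ.support) (hcard : (1 - a) * Fintype.card ι ≤ 1) (n : ℕ)
    {w : ι → ℝ} (hw : w ∈ stdSimplex ℝ ι) :
    ∃ w' ∈ stdSimplex ℝ ι, ∃ c, ReachesOffset β μα μξ a n c ∧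
      (1 - a) • c = β • (∑ i, w i • z i - a ^ n • ∑ i, w' i • z i) := by
  induction n generalizing w with
  | zero => exact ⟨w, hw, 0, reachesOffset_zero a, by simp⟩
  | succ n ih =>
    classical
    obtain ⟨i, -, hi⟩ : ∃ i ∈ Finset.univ, 1 - a ≤ w i := by
      refine Finset.exists_le_of_sum_le (f := fun _ => 1 - a) ?_ ?_
      · by_contra h
        rw [Finset.not_nonempty_iff_eq_empty] at h
        have := hw.2
        rw [h] at this
        simp at this
      · rw [hw.2, Finset.sum_const, Finset.card_univ, nsmul_eq_mul, mul_comm]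
        exact hcard
    set w₁ : ι → ℝ := fun j => (w j - if j = i then 1 - a else 0) / a with hw₁
    have hw₁mem : w₁ ∈ stdSimplex ℝ ι := by
      refine ⟨fun j => div_nonneg ?_ ha0.le, ?_⟩
      · split_ifs with h
        · rw [h]; linarith
        · simpa using hw.1 j
      · rw [← Finset.sum_div, Finset.sum_sub_distrib, hw.2]
        simp [ha0.ne']
    have hdec : ∑ j, w j • z j = (1 - a) • z i + a • ∑ j, w₁ j • z j := by
      have h1 : ∀ j, a • w₁ j • z j = w j • z j - (if j = i then 1 - a else 0) • z j := by
        intro j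
        rw [smul_smul, hw₁, mul_div_cancel₀ _ ha0.ne', sub_smul]
      rw [Finset.smul_sum, Finset.sum_congr rfl fun j _ => h1 j, Finset.sum_sub_distrib]
      simp [ite_smul]
    obtain ⟨w', hw', c, hc, hceq⟩ := ih hw₁mem
    refine ⟨w', hw', a • c + β • z i, hc.succ ha (hz i), ?_⟩
    rw [smul_add, smul_comm, hceq, hdec, pow_succ']
    module

/-- From a bounded set the autoregression enters every ball around the origin with a probability
bounded below: the mean of the noise lies in the closed convex hull of its support, and by
Carathéodory's theorem points of the convex hull are expanded as in a simplex. -/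
theorem exists_pow_arKernel_ball_ge {a : ℝ} (had : (d : ℝ) / (d + 1) ≤ a) (ha0 : 0 < a)
    (ha1 : a < 1) (ha : ∀ u ∈ 𝓝 a, 0 < μα u)
    (hint : Integrable (fun s => s) μξ) (hmean : ∫ s, s ∂μξ = 0) {ε : ℝ} (hε : 0 < ε) (R : ℝ) :
    ∃ N : ℕ, ∃ δ : NNReal, 0 < δ ∧ ∀ x, ‖x‖ ≤ R →
      δ ≤ (arKernel β μα μξ ^ (N + 1)) x (Metric.ball 0 ε) := by
  have h1a : 0 < 1 - a := by linarith
  have h0 : (0 : EuclideanSpace ℝ (Fin d)) ∈ closure (convexHull ℝ μξ.support) := by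
    rw [← hmean]
    refine (convex_convexHull ℝ _).closure.integral_mem isClosed_closure ?_ hint
    filter_upwards [Measure.support_mem_ae] with s hs
    exact subset_closure (subset_convexHull ℝ _ hs)
  -- Membership of `0` in the closure of the convex hull is enough: a point `y` of the hull close to
  -- `0` is expanded, and the error `|β| ‖y‖ / (1 - a)` is at most `ε / 4`.
  obtain ⟨y, hy, hy0⟩ := Metric.mem_closure_iff.1 h0
    ((1 - a) * ε / (4 * (|β| + 1))) (by positivity)
  rw [dist_zero_left] at hy0
  obtain ⟨ι, _, z, w, hz, hzi, hwpos, hwsum, hwz⟩ := eq_pos_convex_span_of_mem_convexHull hy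
  have hcard : (1 - a) * Fintype.card ι ≤ 1 := by
    have h1 := hzi.card_le_finrank_succ
    have h2 : Module.finrank ℝ (vectorSpan ℝ (Set.range z)) ≤ d := by
      simpa using Submodule.finrank_le (vectorSpan ℝ (Set.range z))
    have h3 : (Fintype.card ι : ℝ) ≤ d + 1 := by exact_mod_cast h1.trans (by omega)
    have h4 : (d : ℝ) + 1 > 0 := by positivity
    have h5 : (1 - a) * (d + 1) ≤ 1 := by
      rw [div_le_iff₀ h4] at had
      linarith
    exact (mul_le_mul_of_nonneg_left h3 h1a.le).trans h5
  set D : ℝ := ∑ i, ‖z i‖ with hD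
  have hD0 : 0 ≤ D := Finset.sum_nonneg fun i _ => norm_nonneg _
  have hnorm : ∀ w' ∈ stdSimplex ℝ ι, ‖∑ i, w' i • z i‖ ≤ D := by
    intro w' hw'
    refine (norm_sum_le _ _).trans (Finset.sum_le_sum fun i _ => ?_)
    rw [norm_smul, Real.norm_of_nonneg (hw'.1 i)]
    exact mul_le_of_le_one_left (norm_nonneg _)
      (hw'.2 ▸ Finset.single_le_sum (fun j _ => hw'.1 j) (Finset.mem_univ i))
  have htend : Tendsto (fun n : ℕ => a ^ (n + 1) * (|R| + |β| * D / (1 - a))) atTop (𝓝 0) := by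
    have := ((tendsto_pow_atTop_nhds_zero_of_lt_one ha0.le ha1).comp
      (tendsto_add_atTop_nat 1)).mul_const (|R| + |β| * D / (1 - a))
    simpa using this
  obtain ⟨N, hN⟩ := (htend.eventually_lt_const (show (0 : ℝ) < ε / 4 by positivity)).exists
  obtain ⟨w', hw', c, hc, hceq⟩ := exists_reachesOffset_of_mem_simplex (β := β) ha0 ha
    (fun i => hz (Set.mem_range_self i)) hcard (N + 1) (w := w)
    ⟨fun i => (hwpos i).le, hwsum⟩
  rw [hwz] at hceq
  have hcn : ‖c‖ ≤ ε / 4 + a ^ (N + 1) * (|β| * D / (1 - a)) := by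
    have h1 : (1 - a) * ‖c‖ ≤ |β| * (‖y‖ + a ^ (N + 1) * D) := by
      have h2 := congrArg norm hceq
      rw [norm_smul, norm_smul, Real.norm_of_nonneg h1a.le, Real.norm_eq_abs] at h2
      rw [h2]
      refine mul_le_mul_of_nonneg_left ((norm_sub_le _ _).trans (add_le_add le_rfl ?_))
        (abs_nonneg _)
      rw [norm_smul, Real.norm_of_nonneg (by positivity)]
      exact mul_le_mul_of_nonneg_left (hnorm w' hw') (by positivity)
    have h3 : |β| * ‖y‖ ≤ (1 - a) * (ε / 4) := by
      have h4 : (|β| + 1) * ((1 - a) * ε / (4 * (|β| + 1))) = (1 - a) * (ε / 4) := by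
        field_simp
      rw [← h4]
      exact mul_le_mul (by linarith) hy0.le (norm_nonneg _) (by positivity)
    rw [← mul_le_mul_iff_right₀ h1a]
    calc (1 - a) * ‖c‖ ≤ |β| * (‖y‖ + a ^ (N + 1) * D) := h1
      _ ≤ (1 - a) * (ε / 4) + a ^ (N + 1) * (|β| * D) := by linarith
      _ = _ := by field_simp
  obtain ⟨δ, hδ, hδx⟩ := hc R (ε / 4) (by positivity)
  refine ⟨N, δ, hδ, fun x hx => (hδx x hx).trans (measure_mono ?_)⟩
  refine Metric.ball_subset_ball' ?_
  rw [dist_zero_right]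
  have h5 : ‖a ^ (N + 1) • x‖ ≤ a ^ (N + 1) * |R| := by
    rw [norm_smul, Real.norm_of_nonneg (by positivity)]
    exact mul_le_mul_of_nonneg_left (hx.trans (le_abs_self R)) (by positivity)
  have h6 := norm_add_le (a ^ (N + 1) • x) c
  linarith

/-- Convexity of `x ↦ x ^ c`, applied to `u + v = s (u / s) + (1 - s) (v / (1 - s))` with `s` close
to `1`: the coefficient of `u ^ c` is `s ^ (1 - c)`, close to `1`. -/
theorem exists_rpow_add_le {m c : ℝ} (hm : m < 1) (hc : 1 ≤ c) :
    ∃ k K : ℝ≥0∞, k * ENNReal.ofReal m < 1 ∧ K ≠ ⊤ ∧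
      ∀ u v : ℝ≥0∞, (u + v) ^ c ≤ k * u ^ c + K * v ^ c := by
  have hcont : ContinuousAt (fun s : ℝ => s * s⁻¹ ^ c * m) 1 := by
    refine (continuousAt_id.mul ((continuousAt_inv₀ one_ne_zero).rpow_const ?_)).mul_const m
    exact Or.inr (by linarith)
  have h1 : ∀ᶠ s in 𝓝[<] (1 : ℝ), s * s⁻¹ ^ c * m < 1 :=
    (hcont.eventually_lt_const (by simpa using hm)).filter_mono nhdsWithin_le_nhds
  obtain ⟨s, hsm, hs0, hs1⟩ := (h1.and (Ioo_mem_nhdsLT (zero_lt_one' ℝ))).exists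
  have ht0 : 0 < 1 - s := by linarith
  have hws : ∀ {r : ℝ}, 0 < r → ∀ u : ℝ≥0∞,
      ENNReal.ofReal r * (ENNReal.ofReal r⁻¹ * u) = u := by
    intro r hr u
    rw [← mul_assoc, ← ENNReal.ofReal_mul hr.le, mul_inv_cancel₀ hr.ne', ENNReal.ofReal_one,
      one_mul]
  refine ⟨ENNReal.ofReal (s * s⁻¹ ^ c), ENNReal.ofReal ((1 - s) * (1 - s)⁻¹ ^ c), ?_,
    ENNReal.ofReal_ne_top, fun u v => ?_⟩
  · rw [← ENNReal.ofReal_mul (by positivity)]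
    exact ENNReal.ofReal_lt_one.2 hsm
  · have h2 := ENNReal.rpow_arith_mean_le_arith_mean2_rpow (ENNReal.ofReal s)
      (ENNReal.ofReal (1 - s)) (ENNReal.ofReal s⁻¹ * u) (ENNReal.ofReal (1 - s)⁻¹ * v)
      (by rw [← ENNReal.ofReal_add hs0.le ht0.le]; simp) hc
    rw [hws hs0, hws ht0] at h2
    refine h2.trans_eq ?_
    have hc0 : 0 ≤ c := by linarith
    rw [ENNReal.mul_rpow_of_nonneg _ _ hc0, ENNReal.mul_rpow_of_nonneg _ _ hc0,
      ENNReal.ofReal_rpow_of_pos (inv_pos.2 hs0), ENNReal.ofReal_rpow_of_pos (inv_pos.2 ht0),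
      ENNReal.ofReal_mul hs0.le, ENNReal.ofReal_mul ht0.le, mul_assoc, mul_assoc]

/-- Contraction of the moment of order `c` in mean. -/
theorem exists_rpow_drift_arKernel {c : ℝ} (hc : 1 ≤ c)
    (hα : ∫⁻ a, ‖a‖ₑ ^ c ∂μα < 1) (hξ : ∫⁻ s, ‖s‖ₑ ^ c ∂μξ ≠ ⊤) :
    ∃ l b : ℝ≥0∞, l < 1 ∧ b ≠ ⊤ ∧ ∀ x,
      ∫⁻ y, ‖y‖ₑ ^ c ∂arKernel β μα μξ x ≤ l * ‖x‖ₑ ^ c + b := by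
  have hc0 : 0 ≤ c := by linarith
  have htop : ∫⁻ a, ‖a‖ₑ ^ c ∂μα ≠ ⊤ := (hα.trans ENNReal.one_lt_top).ne
  obtain ⟨k, K, hk, hK, hkK⟩ := exists_rpow_add_le (c := c)
    (ENNReal.toReal_lt_of_lt_ofReal (by simpa using hα)) hc
  rw [ENNReal.ofReal_toReal htop] at hk
  refine ⟨_, K * (‖β‖ₑ ^ c * ∫⁻ s, ‖s‖ₑ ^ c ∂μξ), hk, ENNReal.mul_ne_top hK
    (ENNReal.mul_ne_top (ENNReal.rpow_ne_top_of_nonneg hc0 enorm_ne_top) hξ), fun x => ?_⟩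
  rw [lintegral_arKernel x (by fun_prop)]
  calc ∫⁻ q, ‖q.1 • x + β • q.2‖ₑ ^ c ∂μα.prod μξ
      ≤ ∫⁻ q, k * (‖q.1‖ₑ ^ c * ‖x‖ₑ ^ c) + K * (‖β‖ₑ ^ c * ‖q.2‖ₑ ^ c) ∂μα.prod μξ := by
        refine lintegral_mono fun q => ?_
        refine (ENNReal.rpow_le_rpow (enorm_add_le _ _) hc0).trans ((hkK _ _).trans_eq ?_)
        rw [enorm_smul, enorm_smul, ENNReal.mul_rpow_of_nonneg _ _ hc0,
          ENNReal.mul_rpow_of_nonneg _ _ hc0]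
    _ = k * ((∫⁻ q, ‖q.1‖ₑ ^ c ∂μα.prod μξ) * ‖x‖ₑ ^ c) +
        K * (‖β‖ₑ ^ c * ∫⁻ q, ‖q.2‖ₑ ^ c ∂μα.prod μξ) := by
        rw [lintegral_add_left (by fun_prop), lintegral_const_mul _ (by fun_prop),
          lintegral_mul_const _ (by fun_prop), lintegral_const_mul _ (by fun_prop),
          lintegral_const_mul _ (by fun_prop)]
    _ = _ := by
        rw [lintegral_prod _ (by fun_prop), lintegral_prod _ (by fun_prop)]
        simp only [lintegral_const, measure_univ, mul_one]
        ring

end Autoregression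

/-! ### Independence of the driving sequences -/

section Past

variable {Ω : Type*} {d : ℕ} {α : ℕ → Ω → ℝ} {ξ : ℕ → Ω → EuclideanSpace ℝ (Fin d)}

/-- The driving variables used in the first `t` steps. -/
def drivingPast (α : ℕ → Ω → ℝ) (ξ : ℕ → Ω → EuclideanSpace ℝ (Fin d)) (t : ℕ) (ω : Ω) :
    (Finset.range t → ℝ) × (Finset.range t → EuclideanSpace ℝ (Fin d)) :=
  (fun i => α i ω, fun i => ξ i ω)

/-- The σ-algebra generated by the driving variables of the first `t` steps. -/
abbrev pastSigma (α : ℕ → Ω → ℝ) (ξ : ℕ → Ω → EuclideanSpace ℝ (Fin d)) (t : ℕ) :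
    MeasurableSpace Ω :=
  MeasurableSpace.comap (drivingPast α ξ t) inferInstance

theorem measurable_pastSigma_left {s t : ℕ} (h : s < t) : Measurable[pastSigma α ξ t] (α s) :=
  ((measurable_pi_apply (⟨s, Finset.mem_range.2 h⟩ : Finset.range t)).comp measurable_fst).comp
    (comap_measurable (drivingPast α ξ t))

theorem measurable_pastSigma_right {s t : ℕ} (h : s < t) : Measurable[pastSigma α ξ t] (ξ s) :=
  ((measurable_pi_apply (⟨s, Finset.mem_range.2 h⟩ : Finset.range t)).comp measurable_snd).comp
    (comap_measurable (drivingPast α ξ t))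

theorem pastSigma_mono : Monotone (pastSigma α ξ) := by
  intro s t hst
  rw [← measurable_iff_comap_le]
  let _ := pastSigma α ξ t
  exact Measurable.prodMk (f := fun ω (i : Finset.range s) => α i ω)
    (g := fun ω (i : Finset.range s) => ξ i ω)
    (measurable_pi_lambda _ fun i =>
      measurable_pastSigma_left ((Finset.mem_range.1 i.2).trans_le hst))
    (measurable_pi_lambda _ fun i =>
      measurable_pastSigma_right ((Finset.mem_range.1 i.2).trans_le hst))

end Past

section Driving

variable {Ω : Type*} [MeasurableSpace Ω] {P : Measure Ω} [IsProbabilityMeasure P]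

/-- Regrouping of four variables: if the pairs `(f, f')` and `(g, g')` are independent of each other
and have independent components, then `(f, g)` and `(f', g')` are independent. -/
theorem indepFun_prodMk_of_indepFun {A A' B B' : Type*} [MeasurableSpace A] [MeasurableSpace A']
    [MeasurableSpace B] [MeasurableSpace B'] {f : Ω → A} {f' : Ω → A'} {g : Ω → B} {g' : Ω → B'}
    (hf : Measurable f) (hf' : Measurable f') (hg : Measurable g) (hg' : Measurable g')
    (hff : IndepFun f f' P) (hgg : IndepFun g g' P)
    (hfg : IndepFun (fun ω => (f ω, f' ω)) (fun ω => (g ω, g' ω)) P) :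
    IndepFun (fun ω => (f ω, g ω)) (fun ω => (f' ω, g' ω)) P := by
  have hfg1 : IndepFun f g P := hfg.comp measurable_fst measurable_fst
  have hfg2 : IndepFun f' g' P := hfg.comp measurable_snd measurable_snd
  rw [indepFun_iff_map_prod_eq_prod_map_map (by fun_prop) (by fun_prop)]
  have := Measure.isProbabilityMeasure_map (μ := P) (hf.prodMk hg).aemeasurable
  have := Measure.isProbabilityMeasure_map (μ := P) (hf'.prodMk hg').aemeasurable
  symm
  refine Measure.prod_eq_generateFrom generateFrom_prod generateFrom_prod isPiSystem_prod
    isPiSystem_prod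
    ⟨fun _ => Set.univ, fun _ => ⟨_, MeasurableSet.univ, _, MeasurableSet.univ, Set.univ_prod_univ⟩,
      fun _ => measure_lt_top _ _, Set.iUnion_const _⟩
    ⟨fun _ => Set.univ, fun _ => ⟨_, MeasurableSet.univ, _, MeasurableSet.univ, Set.univ_prod_univ⟩,
      fun _ => measure_lt_top _ _, Set.iUnion_const _⟩ ?_
  rintro _ ⟨s, hs, t, ht, rfl⟩ _ ⟨s', hs', t', ht', rfl⟩
  simp only [Set.mem_ofPred_eq] at hs ht hs' ht'
  rw [Measure.map_apply (by fun_prop) ((hs.prod ht).prod (hs'.prod ht')),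
    Measure.map_apply (by fun_prop) (hs.prod ht), Measure.map_apply (by fun_prop) (hs'.prod ht')]
  have e1 : (fun ω => ((f ω, g ω), (f' ω, g' ω))) ⁻¹' ((s ×ˢ t) ×ˢ (s' ×ˢ t')) =
      (fun ω => (f ω, f' ω)) ⁻¹' (s ×ˢ s') ∩ (fun ω => (g ω, g' ω)) ⁻¹' (t ×ˢ t') := by
    ext ω; simp only [Set.mem_preimage, Set.mem_prod, Set.mem_inter_iff]; tauto
  rw [e1, hfg.measure_inter_preimage_eq_mul _ _ (hs.prod hs') (ht.prod ht')]
  simp only [Set.mk_preimage_prod]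
  rw [hff.measure_inter_preimage_eq_mul _ _ hs hs', hgg.measure_inter_preimage_eq_mul _ _ ht ht',
    hfg1.measure_inter_preimage_eq_mul _ _ hs ht, hfg2.measure_inter_preimage_eq_mul _ _ hs' ht']
  ring

variable {d : ℕ} {α : ℕ → Ω → ℝ} {ξ : ℕ → Ω → EuclideanSpace ℝ (Fin d)}

theorem measurable_drivingPast (hα : ∀ t, Measurable (α t)) (hξ : ∀ t, Measurable (ξ t)) (t : ℕ) :
    Measurable (drivingPast α ξ t) :=
  Measurable.prodMk (f := fun ω (i : Finset.range t) => α i ω)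
    (g := fun ω (i : Finset.range t) => ξ i ω)
    (measurable_pi_lambda _ fun i => hα i) (measurable_pi_lambda _ fun i => hξ i)

theorem pastSigma_le (hα : ∀ t, Measurable (α t)) (hξ : ∀ t, Measurable (ξ t)) (t : ℕ) :
    pastSigma α ξ t ≤ (inferInstance : MeasurableSpace Ω) :=
  (measurable_drivingPast hα hξ t).comap_le

theorem indepFun_drivingPast (hα : ∀ t, Measurable (α t)) (hξ : ∀ t, Measurable (ξ t))
    (hαi : iIndepFun α P) (hξi : iIndepFun ξ P)
    (hαξ : IndepFun (fun ω t => α t ω) (fun ω t => ξ t ω) P) (t : ℕ) :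
    IndepFun (drivingPast α ξ t) (fun ω => (α t ω, ξ t ω)) P := by
  have hdisj : Disjoint (Finset.range t) {t} := by simp
  have h1 : IndepFun (fun ω (i : Finset.range t) => α i ω) (α t) P :=
    (hαi.indepFun_finset _ _ hdisj hα).comp measurable_id
      (measurable_pi_apply (⟨t, Finset.mem_singleton_self t⟩ : ({t} : Finset ℕ)))
  have h2 : IndepFun (fun ω (i : Finset.range t) => ξ i ω) (ξ t) P :=
    (hξi.indepFun_finset _ _ hdisj hξ).comp measurable_id
      (measurable_pi_apply (⟨t, Finset.mem_singleton_self t⟩ : ({t} : Finset ℕ)))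
  refine indepFun_prodMk_of_indepFun (measurable_pi_lambda _ fun i => hα i) (hα t)
    (measurable_pi_lambda _ fun i => hξ i) (hξ t) h1 h2 ?_
  exact hαξ.comp
    (φ := fun a : ℕ → ℝ => ((fun i : Finset.range t => a i), a t))
    (ψ := fun a : ℕ → EuclideanSpace ℝ (Fin d) => ((fun i : Finset.range t => a i), a t))
    (by fun_prop) (by fun_prop)

theorem map_prodMk_driving (hα : ∀ t, Measurable (α t)) (hξ : ∀ t, Measurable (ξ t))
    (hαid : ∀ t, IdentDistrib (α t) (α 0) P P) (hξid : ∀ t, IdentDistrib (ξ t) (ξ 0) P P)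
    (hαξ : IndepFun (fun ω t => α t ω) (fun ω t => ξ t ω) P) (t : ℕ) :
    P.map (fun ω => (α t ω, ξ t ω)) = (P.map (α 0)).prod (P.map (ξ 0)) := by
  have h : IndepFun (α t) (ξ t) P := hαξ.comp (measurable_pi_apply t) (measurable_pi_apply t)
  rw [h.map_prod_eq_prod_map_map (hα t).aemeasurable (hξ t).aemeasurable, (hαid t).map_eq,
    (hξid t).map_eq]

/-- The Markov property: on an event `D` of the past, the variables of the next step are
independent of every past variable `U`. -/
theorem map_restrict_prodMk_driving {F : Type*} [MeasurableSpace F]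
    {μ : Measure (ℝ × EuclideanSpace ℝ (Fin d))} [IsProbabilityMeasure μ]
    (hα : ∀ t, Measurable (α t)) (hξ : ∀ t, Measurable (ξ t)) {t : ℕ}
    (hind : IndepFun (drivingPast α ξ t) (fun ω => (α t ω, ξ t ω)) P)
    (hlaw : P.map (fun ω => (α t ω, ξ t ω)) = μ)
    {D : Set Ω} (hD : MeasurableSet[pastSigma α ξ t] D) {U : Ω → F}
    (hU : Measurable[pastSigma α ξ t] U) :
    (P.restrict D).map (fun ω => (U ω, (α t ω, ξ t ω))) = ((P.restrict D).map U).prod μ := by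
  have hUm : Measurable U := hU.mono (pastSigma_le hα hξ t) le_rfl
  have hDm : MeasurableSet D := pastSigma_le hα hξ t _ hD
  have hZ : Measurable fun ω => (α t ω, ξ t ω) := (hα t).prodMk (hξ t)
  symm
  refine Measure.prod_eq fun s q hs hq => ?_
  rw [Measure.map_apply (hUm.prodMk hZ) (hs.prod hq), Measure.map_apply hUm hs,
    Measure.restrict_apply (hUm hs), Measure.restrict_apply (hUm.prodMk hZ (hs.prod hq)), ← hlaw,
    Measure.map_apply hZ hq, Set.mk_preimage_prod, Set.inter_right_comm]
  exact (Indep_iff _ _ P).1 hind _ _ ((hU hs).inter hD) ⟨q, hq, rfl⟩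

end Driving

/-! ### The restart time and the laws of the two sequences -/

section Cycle

variable {Ω : Type*} {d : ℕ} {β : ℝ} {S : Set (EuclideanSpace ℝ (Fin d))}
  {α : ℕ → Ω → ℝ} {ξ : ℕ → Ω → EuclideanSpace ℝ (Fin d)}

/-- The event that the autoregression avoids `S` at the times `1, …, j`. -/
def avoids (β : ℝ) (S : Set (EuclideanSpace ℝ (Fin d))) (α : ℕ → Ω → ℝ)
    (ξ : ℕ → Ω → EuclideanSpace ℝ (Fin d)) (j : ℕ) : Set Ω :=
  {ω | ∀ i, 1 ≤ i → i ≤ j → arSeq β α ξ i ω ∉ S}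

theorem avoids_zero : avoids β S α ξ 0 = Set.univ := by
  ext ω
  simp only [avoids, Set.mem_ofPred_eq, Set.mem_univ, iff_true]
  omega

theorem avoids_succ (j : ℕ) :
    avoids β S α ξ (j + 1) = avoids β S α ξ j ∩ arSeq β α ξ (j + 1) ⁻¹' Sᶜ := by
  ext ω
  simp only [avoids, Set.mem_ofPred_eq, Set.mem_inter_iff, Set.mem_preimage, Set.mem_compl_iff]
  refine ⟨fun h => ⟨fun i h1 h2 => h i h1 (by omega), h _ (by omega) le_rfl⟩, fun h i h1 h2 => ?_⟩
  rcases Nat.lt_or_ge i (j + 1) with h3 | h3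
  · exact h.1 i h1 (by omega)
  · obtain rfl : i = j + 1 := by omega
    exact h.2

theorem succ_le_restartTime_iff {j : ℕ} {ω : Ω} :
    ((j + 1 : ℕ) : ℕ∞) ≤ restartTime β S α ξ ω ↔ ω ∈ avoids β S α ξ j := by
  rw [← not_iff_not, not_le]
  have h1 : restartTime β S α ξ ω < ((j + 1 : ℕ) : ℕ∞) ↔
      restartTime β S α ξ ω ≤ (j : ℕ∞) := by
    rw [Nat.cast_succ]
    exact ENat.lt_natCast_add_one_iff
  rw [h1]
  refine (hittingAfter_le_iff (u := arSeq β α ξ) (s := S) (n := 1) (i := j) (ω := ω)).trans ?_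
  simp only [avoids, Set.mem_ofPred_eq, Set.mem_Icc]
  push Not
  exact ⟨fun ⟨i, ⟨h1, h2⟩, h3⟩ => ⟨i, h1, h2, h3⟩, fun ⟨i, h1, h2, h3⟩ => ⟨i, ⟨h1, h2⟩, h3⟩⟩

theorem restartTime_eq_succ_iff {t : ℕ} {ω : Ω} :
    restartTime β S α ξ ω = ((t + 1 : ℕ) : ℕ∞) ↔
      ω ∈ avoids β S α ξ t ∩ arSeq β α ξ (t + 1) ⁻¹' S := by
  have h1 : restartTime β S α ξ ω = ((t + 1 : ℕ) : ℕ∞) ↔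
      ((t + 1 : ℕ) : ℕ∞) ≤ restartTime β S α ξ ω ∧
        ¬ ((t + 1 + 1 : ℕ) : ℕ∞) ≤ restartTime β S α ξ ω := by
    rw [not_le, Nat.cast_succ (t + 1), ENat.lt_natCast_add_one_iff, le_antisymm_iff, and_comm]
  rw [h1, succ_le_restartTime_iff, succ_le_restartTime_iff, avoids_succ]
  simp only [Set.mem_inter_iff, Set.mem_preimage, Set.mem_compl_iff]
  tauto

theorem setOf_succ_le_restartTime (j : ℕ) :
    {ω | ((j + 1 : ℕ) : ℕ∞) ≤ restartTime β S α ξ ω} = avoids β S α ξ j :=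
  Set.ext fun _ => succ_le_restartTime_iff

theorem ENat.toENNReal_eq_tsum_ite (n : ℕ∞) :
    (n : ℝ≥0∞) = ∑' j : ℕ, if ((j + 1 : ℕ) : ℕ∞) ≤ n then 1 else 0 := by
  induction n using ENat.recTopCoe with
  | top => simp
  | coe n =>
    rw [tsum_eq_sum (s := Finset.range n)]
    · rw [Finset.sum_congr rfl fun j hj => if_pos ?_]
      · simp
      · have := Finset.mem_range.1 hj
        exact_mod_cast this
    · intro j hj
      refine if_neg ?_
      have : ¬ j < n := fun h => hj (Finset.mem_range.2 h)
      rw [not_le]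
      exact_mod_cast (by omega : n < j + 1)

theorem restartTime_eq_tsum (ω : Ω) :
    (restartTime β S α ξ ω : ℝ≥0∞) =
      ∑' j : ℕ, (avoids β S α ξ j).indicator (fun _ => 1) ω := by
  classical
  rw [ENat.toENNReal_eq_tsum_ite]
  refine tsum_congr fun j => ?_
  rw [Set.indicator_apply]
  exact if_congr succ_le_restartTime_iff rfl rfl

theorem measurable_pastSigma_arSeq (t : ℕ) :
    Measurable[pastSigma α ξ t] (arSeq β α ξ t) := by
  induction t with
  | zero => exact measurable_const
  | succ t ih =>
    let _ := pastSigma α ξ (t + 1)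
    have h1 : Measurable (α t) := measurable_pastSigma_left t.lt_succ_self
    have h2 : Measurable (ξ t) := measurable_pastSigma_right t.lt_succ_self
    have h3 : Measurable (arSeq β α ξ t) := ih.mono (pastSigma_mono t.le_succ) le_rfl
    exact (h1.smul h3).add (h2.const_smul β)

theorem measurableSet_pastSigma_avoids (hS : MeasurableSet S) (j : ℕ) :
    MeasurableSet[pastSigma α ξ j] (avoids β S α ξ j) := by
  induction j with
  | zero => rw [avoids_zero]; exact MeasurableSet.univ
  | succ j ih =>
    rw [avoids_succ]
    exact (pastSigma_mono j.le_succ _ ih).inter (measurable_pastSigma_arSeq _ hS.compl)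

theorem measurable_restartStep (hS : MeasurableSet S) :
    Measurable (restartStep (d := d) β S) := by
  have h : Measurable fun p : EuclideanSpace ℝ (Fin d) × ℝ × EuclideanSpace ℝ (Fin d) =>
      (Sᶜ.indicator id p.1, p.2) :=
    ((measurable_id.indicator hS.compl).comp measurable_fst).prodMk measurable_snd
  exact (measurable_arStep β).comp h

theorem measurable_pastSigma_restartSeq (hS : MeasurableSet S) (t : ℕ) :
    Measurable[pastSigma α ξ t] (restartSeq β S α ξ t) := by
  induction t with
  | zero => exact measurable_const
  | succ t ih =>
    let _ := pastSigma α ξ (t + 1)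
    have h1 : Measurable (α t) := measurable_pastSigma_left t.lt_succ_self
    have h2 : Measurable (ξ t) := measurable_pastSigma_right t.lt_succ_self
    have h3 : Measurable (restartSeq β S α ξ t) := ih.mono (pastSigma_mono t.le_succ) le_rfl
    exact (measurable_restartStep hS).comp (h3.prodMk (h1.prodMk h2))

/-- The transition of the chain with restart, acting on measures, is the abstract regeneration step
of the autoregression kernel at the restart point `0`. -/
theorem map_restartStep (hS : MeasurableSet S) {μα : Measure ℝ}
    {μξ : Measure (EuclideanSpace ℝ (Fin d))} [IsProbabilityMeasure μα] [IsProbabilityMeasure μξ]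
    (ν : Measure (EuclideanSpace ℝ (Fin d))) [SFinite ν] :
    (ν.prod (μα.prod μξ)).map (restartStep β S) = regenStep (arKernel β μα μξ) S 0 ν := by
  refine Measure.ext_of_lintegral _ fun g hg => ?_
  rw [lintegral_map hg (measurable_restartStep hS),
    lintegral_prod (fun p => g (restartStep β S p))
      (hg.comp (measurable_restartStep hS)).aemeasurable,
    regenStep, lintegral_add_measure, lintegral_smul_measure, lintegral_killedStep _ hg,
    ← lintegral_add_compl _ hS]
  congr 1
  · rw [setLIntegral_congr_fun (g := fun _ => ∫⁻ y, g y ∂arKernel β μα μξ 0) hS,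
      setLIntegral_const, mul_comm, smul_eq_mul]
    intro y hy
    change _ = ∫⁻ y, g y ∂arKernel β μα μξ 0
    rw [lintegral_arKernel _ hg]
    simp only [restartStep, Set.indicator_of_notMem (Set.notMem_compl_iff.2 hy)]
  · refine setLIntegral_congr_fun hS.compl fun y hy => ?_
    change _ = ∫⁻ z, g z ∂arKernel β μα μξ y
    rw [lintegral_arKernel _ hg]
    simp only [restartStep, Set.indicator_of_mem hy, id]

theorem sum_Icc_restartTime_eq_tsum {B : Set (EuclideanSpace ℝ (Fin d))} {ω : Ω}
    (hω : restartTime β S α ξ ω < ⊤) :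
    ∑ j ∈ Finset.Icc 1 (restartTime β S α ξ ω).toNat,
        B.indicator (fun _ => (1 : ℝ≥0∞)) (arSeq β α ξ j ω) =
      ∑' j : ℕ, B.indicator (fun _ => (1 : ℝ≥0∞)) (arSeq β α ξ (j + 1) ω) *
        {ω' | ((j + 1 : ℕ) : ℕ∞) ≤ restartTime β S α ξ ω'}.indicator (fun _ => (1 : ℝ≥0∞)) ω := by
  obtain ⟨n, hn⟩ := ENat.ne_top_iff_exists.1 hω.ne
  have hmem : ∀ j, ω ∈ avoids β S α ξ j ↔ j < n := fun j => by
    rw [← succ_le_restartTime_iff, ← hn]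
    exact_mod_cast Nat.succ_le_iff
  simp_rw [setOf_succ_le_restartTime]
  rw [tsum_eq_sum (s := Finset.range n), ← hn, ENat.toNat_natCast,
    ← Finset.Ico_add_one_right_eq_Icc, Finset.sum_Ico_eq_sum_range]
  · refine Finset.sum_congr (by simp) fun j hj => ?_
    rw [Set.indicator_of_mem ((hmem j).2 (by simpa using hj)), mul_one, add_comm]
  · intro j hj
    rw [Set.indicator_of_notMem fun h => hj (Finset.mem_range.2 ((hmem j).1 h)), mul_zero]

theorem ae_restartTime_lt_top [MeasurableSpace Ω] {P : Measure Ω} {C r : ℝ} (hr : 0 < r) (hr1 : r < 1)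
    (hdec : ∀ j, P (avoids β S α ξ j) ≤ ENNReal.ofReal (C * r ^ j)) :
    ∀ᵐ ω ∂P, restartTime β S α ξ ω < ⊤ := by
  have hlim : Tendsto (fun j : ℕ => ENNReal.ofReal (C * r ^ j)) atTop (𝓝 0) := by
    have := (tendsto_pow_atTop_nhds_zero_of_lt_one hr.le hr1).const_mul C
    simpa using ENNReal.tendsto_ofReal this
  rw [ae_iff]
  refine le_antisymm (ge_of_tendsto' hlim fun j => ?_) zero_le
  refine (measure_mono fun ω hω => ?_).trans (hdec j)
  have hω' : restartTime β S α ξ ω = ⊤ := not_lt_top_iff.1 hω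
  rw [← succ_le_restartTime_iff, hω']
  exact le_top

variable [MeasurableSpace Ω] {P : Measure Ω} [IsProbabilityMeasure P]
  {μα : Measure ℝ} {μξ : Measure (EuclideanSpace ℝ (Fin d))} [IsProbabilityMeasure μα]
  [IsProbabilityMeasure μξ]

/-- The law of the autoregression at time `j + 1`, on the event that the cycle is not over before,
is given by the killed chain. -/
theorem map_restrict_avoids_arSeq (hα : ∀ t, Measurable (α t)) (hξ : ∀ t, Measurable (ξ t))
    (hind : ∀ t, IndepFun (drivingPast α ξ t) (fun ω => (α t ω, ξ t ω)) P)
    (hlaw : ∀ t, P.map (fun ω => (α t ω, ξ t ω)) = μα.prod μξ) (hS : MeasurableSet S) (j : ℕ) :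
    (P.restrict (avoids β S α ξ j)).map (arSeq β α ξ (j + 1)) =
      excursion (arKernel β μα μξ) S 0 j := by
  have hX : ∀ t, Measurable (arSeq β α ξ t) := fun t =>
    (measurable_pastSigma_arSeq t).mono (pastSigma_le hα hξ t) le_rfl
  have hstep : ∀ j, (P.restrict (avoids β S α ξ j)).map (arSeq β α ξ (j + 1)) =
      arKernel β μα μξ ∘ₘ (P.restrict (avoids β S α ξ j)).map (arSeq β α ξ j) := by
    intro j
    rw [arKernel_comp, ← map_restrict_prodMk_driving hα hξ (hind j) (hlaw j)
      (measurableSet_pastSigma_avoids hS j) (measurable_pastSigma_arSeq j),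
      Measure.map_map (measurable_arStep β) ((hX j).prodMk ((hα j).prodMk (hξ j)))]
    rfl
  induction j with
  | zero =>
    rw [hstep, avoids_zero, Measure.restrict_univ, excursion_zero,
      show arSeq β α ξ 0 = fun _ => 0 from rfl, Measure.map_const, measure_univ, one_smul,
      Measure.dirac_bind (arKernel β μα μξ).measurable]
  | succ j ih =>
    rw [hstep, excursion_succ, ← ih, avoids_succ, Set.inter_comm,
      ← Measure.restrict_restrict (hX _ hS.compl)]
    change _ = arKernel β μα μξ ∘ₘ _
    rw [Measure.restrict_map (hX _) hS.compl]

theorem measure_avoids_inter_preimage (hα : ∀ t, Measurable (α t)) (hξ : ∀ t, Measurable (ξ t))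
    (hind : ∀ t, IndepFun (drivingPast α ξ t) (fun ω => (α t ω, ξ t ω)) P)
    (hlaw : ∀ t, P.map (fun ω => (α t ω, ξ t ω)) = μα.prod μξ) (hS : MeasurableSet S) (j : ℕ)
    {B : Set (EuclideanSpace ℝ (Fin d))} (hB : MeasurableSet B) :
    P (avoids β S α ξ j ∩ arSeq β α ξ (j + 1) ⁻¹' B) =
      excursion (arKernel β μα μξ) S 0 j B := by
  have hX : Measurable (arSeq β α ξ (j + 1)) :=
    (measurable_pastSigma_arSeq _).mono (pastSigma_le hα hξ _) le_rfl
  rw [← map_restrict_avoids_arSeq hα hξ hind hlaw hS j, Measure.map_apply hX hB,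
    Measure.restrict_apply (hX hB), Set.inter_comm]

theorem map_restartSeq (hα : ∀ t, Measurable (α t)) (hξ : ∀ t, Measurable (ξ t))
    (hind : ∀ t, IndepFun (drivingPast α ξ t) (fun ω => (α t ω, ξ t ω)) P)
    (hlaw : ∀ t, P.map (fun ω => (α t ω, ξ t ω)) = μα.prod μξ) (hS : MeasurableSet S)
    (h0 : 0 ∈ S) (t : ℕ) :
    P.map (restartSeq β S α ξ (t + 1)) =
      (regenStep (arKernel β μα μξ) S 0)^[t] (arKernel β μα μξ 0) := by
  have hY : ∀ t, Measurable (restartSeq β S α ξ t) := fun t =>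
    (measurable_pastSigma_restartSeq hS t).mono (pastSigma_le hα hξ t) le_rfl
  have hstep : ∀ t, P.map (restartSeq β S α ξ (t + 1)) =
      regenStep (arKernel β μα μξ) S 0 (P.map (restartSeq β S α ξ t)) := by
    intro t
    have h := map_restrict_prodMk_driving hα hξ (hind t) (hlaw t) (D := Set.univ)
      MeasurableSet.univ (measurable_pastSigma_restartSeq (β := β) hS t)
    rw [Measure.restrict_univ] at h
    rw [← map_restartStep hS, ← h,
      Measure.map_map (measurable_restartStep hS) ((hY t).prodMk ((hα t).prodMk (hξ t)))]
    rfl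
  induction t with
  | zero =>
    rw [hstep, show restartSeq β S α ξ 0 = fun _ => 0 from rfl, Measure.map_const, measure_univ,
      one_smul, regenStep, Measure.dirac_apply' _ hS]
    have h1 : (Measure.dirac (0 : EuclideanSpace ℝ (Fin d))).restrict Sᶜ = 0 := by
      rw [Measure.restrict_eq_zero, Measure.dirac_apply' _ hS.compl]
      simp [h0]
    have h2 : killedStep (arKernel β μα μξ) S (Measure.dirac 0) = 0 := by
      change arKernel β μα μξ ∘ₘ _ = 0
      rw [h1]
      simp
    rw [h2]
    simp [h0]
  | succ t ih => rw [hstep, ih, Function.iterate_succ_apply']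

theorem lintegral_tsum_visits (hα : ∀ t, Measurable (α t)) (hξ : ∀ t, Measurable (ξ t))
    (hind : ∀ t, IndepFun (drivingPast α ξ t) (fun ω => (α t ω, ξ t ω)) P)
    (hlaw : ∀ t, P.map (fun ω => (α t ω, ξ t ω)) = μα.prod μξ) (hS : MeasurableSet S)
    {B : Set (EuclideanSpace ℝ (Fin d))} (hB : MeasurableSet B) :
    ∫⁻ ω, ∑' j : ℕ, B.indicator (fun _ => (1 : ℝ≥0∞)) (arSeq β α ξ (j + 1) ω) *
        {ω' | ((j + 1 : ℕ) : ℕ∞) ≤ restartTime β S α ξ ω'}.indicator (fun _ => (1 : ℝ≥0∞)) ω ∂P =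
      cycleOccupation (arKernel β μα μξ) S 0 B := by
  have hX : ∀ t, Measurable (arSeq β α ξ t) := fun t =>
    (measurable_pastSigma_arSeq _).mono (pastSigma_le hα hξ _) le_rfl
  have hD : ∀ j, MeasurableSet (avoids β S α ξ j) := fun j =>
    pastSigma_le hα hξ j _ (measurableSet_pastSigma_avoids hS j)
  have hterm : ∀ j ω, B.indicator (fun _ => (1 : ℝ≥0∞)) (arSeq β α ξ (j + 1) ω) *
      {ω' | ((j + 1 : ℕ) : ℕ∞) ≤ restartTime β S α ξ ω'}.indicator (fun _ => (1 : ℝ≥0∞)) ω =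
      (avoids β S α ξ j ∩ arSeq β α ξ (j + 1) ⁻¹' B).indicator 1 ω := by
    intro j ω
    rw [setOf_succ_le_restartTime]
    by_cases h1 : ω ∈ avoids β S α ξ j <;> by_cases h2 : arSeq β α ξ (j + 1) ω ∈ B <;>
      simp [h1, h2]
  simp_rw [hterm]
  rw [lintegral_tsum fun j =>
      (measurable_one.indicator ((hD j).inter (hX (j + 1) hB))).aemeasurable,
    cycleOccupation_apply hB]
  refine tsum_congr fun j => ?_
  rw [lintegral_indicator_one ((hD j).inter (hX (j + 1) hB)),
    measure_avoids_inter_preimage hα hξ hind hlaw hS j hB]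

theorem lintegral_restartTime (hα : ∀ t, Measurable (α t)) (hξ : ∀ t, Measurable (ξ t))
    (hind : ∀ t, IndepFun (drivingPast α ξ t) (fun ω => (α t ω, ξ t ω)) P)
    (hlaw : ∀ t, P.map (fun ω => (α t ω, ξ t ω)) = μα.prod μξ) (hS : MeasurableSet S) :
    ∫⁻ ω, (restartTime β S α ξ ω : ℝ≥0∞) ∂P =
      cycleOccupation (arKernel β μα μξ) S 0 Set.univ := by
  rw [← lintegral_tsum_visits hα hξ hind hlaw hS MeasurableSet.univ]
  refine lintegral_congr fun ω => ?_
  rw [restartTime_eq_tsum]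
  refine tsum_congr fun j => ?_
  rw [setOf_succ_le_restartTime]
  simp

/-- Geometric tails give a finite exponential moment: on `{τ = j + 1}` the exponential is one of the
terms of `∑ j, exp (c (j + 1)) 1{τ ≥ j + 1}`. -/
theorem exists_lintegral_exp_restartTime_lt_top {C r : ℝ} (hr : 0 < r) (hr1 : r < 1)
    (hD : ∀ j, MeasurableSet (avoids β S α ξ j))
    (hdec : ∀ j, P (avoids β S α ξ j) ≤ ENNReal.ofReal (C * r ^ j)) :
    ∃ c : ℝ, 0 < c ∧
      ∫⁻ ω, ENNReal.ofReal (Real.exp (c * (restartTime β S α ξ ω).toNat)) ∂P < ⊤ := by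
  have hlog : Real.log r < 0 := Real.log_neg hr hr1
  -- `exp c = r ^ (-1 / 2)`, so that `exp c * r < 1`
  set c : ℝ := -Real.log r / 2 with hc
  refine ⟨c, by rw [hc]; linarith, ?_⟩
  have hcr : Real.exp c * r < 1 := by
    rw [← Real.exp_log hr, ← Real.exp_add, Real.exp_lt_one_iff, hc]
    linarith
  have hpt : ∀ ω, ENNReal.ofReal (Real.exp (c * (restartTime β S α ξ ω).toNat)) ≤
      1 + ∑' j : ℕ, ENNReal.ofReal (Real.exp c ^ (j + 1)) *
        (avoids β S α ξ j).indicator 1 ω := by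
    intro ω
    rcases hk : (restartTime β S α ξ ω).toNat with _ | k
    · simp
    · refine le_trans ?_ le_add_self
      have hmem : ω ∈ avoids β S α ξ k := by
        rw [← succ_le_restartTime_iff, ← hk]
        exact ENat.natCast_toNat_le_self _
      refine le_trans (le_of_eq ?_) (ENNReal.le_tsum k)
      rw [Set.indicator_of_mem hmem, Pi.one_apply, mul_one, ← Real.exp_nat_mul, mul_comm c]
  refine (lintegral_mono hpt).trans_lt ?_
  rw [lintegral_add_left measurable_const, lintegral_const, measure_univ, mul_one,
    lintegral_tsum fun j => ((measurable_one.indicator (hD j)).const_mul _).aemeasurable]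
  refine ENNReal.add_lt_top.2 ⟨ENNReal.one_lt_top, ?_⟩
  have hterm : ∀ j : ℕ, ∫⁻ ω, ENNReal.ofReal (Real.exp c ^ (j + 1)) *
      (avoids β S α ξ j).indicator 1 ω ∂P ≤
        ENNReal.ofReal (Real.exp c * |C| * (Real.exp c * r) ^ j) := by
    intro j
    rw [lintegral_const_mul _ (measurable_one.indicator (hD j)), lintegral_indicator_one (hD j)]
    refine (mul_le_mul' le_rfl (hdec j)).trans ?_
    rw [← ENNReal.ofReal_mul (by positivity)]
    refine ENNReal.ofReal_le_ofReal ?_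
    calc Real.exp c ^ (j + 1) * (C * r ^ j) ≤ Real.exp c ^ (j + 1) * (|C| * r ^ j) := by
          gcongr; exact le_abs_self C
      _ = _ := by ring
  refine (ENNReal.tsum_le_tsum hterm).trans_lt ?_
  rw [← ENNReal.ofReal_tsum_of_nonneg (fun j => by positivity)
    ((summable_geometric_of_lt_one (by positivity) hcr).mul_left _)]
  exact ENNReal.ofReal_lt_top

end Cycle

/-! ### Stationarity and convergence of the restarted autoregression -/

theorem lintegral_enorm_map_lt_one_of_integral_lt_one {Ω : Type*} [MeasurableSpace Ω]
    {P : Measure Ω} {f : Ω → ℝ} (hf : Measurable f) (hpos : ∀ᵐ ω ∂P, 0 < f ω) {c : ℝ}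
    (hint : Integrable (fun ω => f ω ^ c) P) (hlt : ∫ ω, f ω ^ c ∂P < 1) :
    ∫⁻ a, ‖a‖ₑ ^ c ∂P.map f < 1 := by
  rw [lintegral_map (by fun_prop) hf]
  have h1 : ∀ᵐ ω ∂P, ‖f ω‖ₑ ^ c = ENNReal.ofReal (f ω ^ c) := by
    filter_upwards [hpos] with ω hω
    rw [Real.enorm_of_nonneg hω.le, ENNReal.ofReal_rpow_of_pos hω]
  rw [lintegral_congr_ae h1, ← ofReal_integral_eq_lintegral_ofReal hint
    (hpos.mono fun ω hω => (Real.rpow_pos_of_pos hω c).le)]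
  exact ENNReal.ofReal_lt_one.2 hlt

theorem exists_mem_Ico_forall_nhds_pos {μ : Measure ℝ} {a b : ℝ} (h0 : ∀ᵐ x ∂μ, 0 < x)
    (h : 0 < μ (Set.Ico a b)) :
    ∃ x, a ≤ x ∧ 0 < x ∧ x < b ∧ ∀ u ∈ 𝓝 x, 0 < μ u := by
  have h1 : μ (Set.Ico a b ∩ Set.Ioi 0) ≠ 0 := by
    rw [Set.inter_comm, Measure.measure_inter_eq_of_ae (t := Set.Ioi 0) h0]
    exact h.ne'
  obtain ⟨x, hx, hxu⟩ := exists_mem_forall_mem_nhdsWithin_pos_measure h1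
  exact ⟨x, hx.1.1, hx.2, hx.1.2, fun u hu => hxu u (mem_nhdsWithin_of_mem_nhds hu)⟩

/-- The Foster–Lyapunov criterion for the autoregression, with `V = ‖·‖`: the first moment is
contracted because `E α < 1`, and the ball around the origin contained in `S` is reached by
steering. -/
theorem exists_contraction_arKernel {d : ℕ} {β : ℝ} {μα : Measure ℝ}
    {μξ : Measure (EuclideanSpace ℝ (Fin d))} [IsProbabilityMeasure μα] [IsProbabilityMeasure μξ]
    (hpos : ∀ᵐ a ∂μα, 0 < a) (hl : ∫⁻ a, ‖a‖ₑ ∂μα < 1)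
    (hsupp : 0 < μα (Set.Ico ((d : ℝ) / (d + 1)) 1))
    (hint : Integrable (fun s => s) μξ) (hmean : ∫ s, s ∂μξ = 0)
    {S : Set (EuclideanSpace ℝ (Fin d))} (hS : MeasurableSet S) {r : ℝ} (hr : 0 < r)
    (hball : Metric.ball 0 r ⊆ S) :
    ∃ N : ℕ, ∃ ε : NNReal, ∃ ρ : ℝ, 0 < ρ ∧ ρ < 1 ∧ ∀ x,
      ∫⁻ y in Sᶜ, (1 + ε * ‖y‖₊ : NNReal) ∂(arKernel β μα μξ ^ (N + 1)) x ≤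
        ENNReal.ofReal ρ * (1 + ε * ‖x‖₊ : NNReal) := by
  obtain ⟨a, had, ha0, ha1, ha⟩ := exists_mem_Ico_forall_nhds_pos hpos hsupp
  have hξ : ∫⁻ s, ‖s‖ₑ ∂μξ ≠ ⊤ := hint.2.ne
  lift ∫⁻ a, ‖a‖ₑ ∂μα to NNReal using (hl.trans ENNReal.one_lt_top).ne with l hl'
  have hb : ‖β‖ₑ * ∫⁻ s, ‖s‖ₑ ∂μξ ≠ ⊤ := ENNReal.mul_ne_top enorm_ne_top hξ
  refine exists_contraction_of_drift hS measurable_nnnorm (l := l)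
    (b := (‖β‖ₑ * ∫⁻ s, ‖s‖ₑ ∂μξ).toNNReal) (by exact_mod_cast hl)
    (lintegral_nnnorm_arKernel_le hl'.symm (ENNReal.coe_toNNReal hb).symm) fun R => ?_
  obtain ⟨N, δ, hδ, h⟩ := exists_pow_arKernel_ball_ge (β := β) had ha0 ha1 ha hint hmean hr R
  exact ⟨N, δ, hδ, fun x hx => (h x (by exact_mod_cast hx)).trans (measure_mono hball)⟩

theorem mainTheorem6
    {Ω : Type*} [MeasurableSpace Ω] (P : Measure Ω) [IsProbabilityMeasure P] (d : ℕ)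
    -- the restart set `γ • A`
    (A : Set (EuclideanSpace ℝ (Fin d))) (hA : MeasurableSet A)
    (r₁ r₂ : ℝ) (hr₁ : 0 < r₁) (hA₁ : Metric.ball 0 r₁ ⊆ A) (hA₂ : A ⊆ Metric.ball 0 r₂)
    (β γ : ℝ) (hγ : 0 < γ)
    -- two independent i.i.d. sequences
    (α : ℕ → Ω → ℝ) (ξ : ℕ → Ω → EuclideanSpace ℝ (Fin d))
    (hαm : ∀ t, Measurable (α t)) (hξm : ∀ t, Measurable (ξ t))
    (hα_indep : iIndepFun α P) (hα_ident : ∀ t, IdentDistrib (α t) (α 0) P P)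
    (hξ_indep : iIndepFun ξ P) (hξ_ident : ∀ t, IdentDistrib (ξ t) (ξ 0) P P)
    (hαξ : IndepFun (fun ω t => α t ω) (fun ω t => ξ t ω) P)
    -- the coefficient
    (hα_pos : ∀ᵐ ω ∂P, 0 < α 0 ω)
    (hα_int : Integrable (α 0) P) (hα_mean : ∫ ω, α 0 ω ∂P < 1)
    (hα_supp : 0 < P {ω | α 0 ω ∈ Set.Ico ((d : ℝ) / (d + 1)) 1})
    -- the noise
    (hξ_sq : MemLp (ξ 0) 2 P) (hξ_mean : ∫ ω, ξ 0 ω ∂P = 0)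
    (hξ_rank : (Matrix.of fun i j : Fin d => ∫ ω, ξ 0 ω i * ξ 0 ω j ∂P).rank = d) :
    -- (i)
    ((∀ᵐ ω ∂P, restartTime β (γ • A) α ξ ω < ⊤) ∧
      ∃ c : ℝ, 0 < c ∧
        ∫⁻ ω, ENNReal.ofReal (Real.exp (c * (restartTime β (γ • A) α ξ ω).toNat)) ∂P < ⊤) ∧
    ∃ π : ProbabilityMeasure (EuclideanSpace ℝ (Fin d)),
      -- (ii): `π` is the average over a regenerative cycle, in both forms
      (∀ B : Set (EuclideanSpace ℝ (Fin d)), MeasurableSet B →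
        (π : Measure (EuclideanSpace ℝ (Fin d))) B =
          (∫⁻ ω, (restartTime β (γ • A) α ξ ω : ℝ≥0∞) ∂P)⁻¹ *
            ∫⁻ ω, ∑ j ∈ Finset.Icc 1 (restartTime β (γ • A) α ξ ω).toNat,
              B.indicator (fun _ => (1 : ℝ≥0∞)) (arSeq β α ξ j ω) ∂P ∧
        (π : Measure (EuclideanSpace ℝ (Fin d))) B =
          (∫⁻ ω, (restartTime β (γ • A) α ξ ω : ℝ≥0∞) ∂P)⁻¹ *
            ∫⁻ ω, ∑' j : ℕ, B.indicator (fun _ => (1 : ℝ≥0∞)) (arSeq β α ξ (j + 1) ω) *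
              {ω' | ((j + 1 : ℕ) : ℕ∞) ≤ restartTime β (γ • A) α ξ ω'}.indicator
                (fun _ => (1 : ℝ≥0∞)) ω ∂P) ∧
      -- (ii): `π` is the unique stationary distribution
      IsStationaryLaw β (γ • A) (P.map (α 0)) (P.map (ξ 0)) π ∧
      (∀ π' : Measure (EuclideanSpace ℝ (Fin d)), IsProbabilityMeasure π' →
        IsStationaryLaw β (γ • A) (P.map (α 0)) (P.map (ξ 0)) π' → π' = π) ∧
      -- (ii): total variation convergence, the cycle length being aperiodic
      ((∀ n : ℕ, (∀ t : ℕ, P {ω | restartTime β (γ • A) α ξ ω = t} ≠ 0 → n ∣ t) → n = 1) →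
        Tendsto (fun t : ℕ =>
          ((P.map (restartSeq β (γ • A) α ξ t)).toSignedMeasure -
            (π : Measure (EuclideanSpace ℝ (Fin d))).toSignedMeasure).totalVariation Set.univ)
          atTop (𝓝 0)) ∧
      -- (iii)
      (∀ c : ℝ, 1 < c →
        Integrable (fun ω => α 0 ω ^ c) P → ∫ ω, α 0 ω ^ c ∂P < 1 →
        Integrable (fun ω => ‖ξ 0 ω‖ ^ c) P →
        Integrable (fun y => ‖y‖ ^ c) (π : Measure (EuclideanSpace ℝ (Fin d)))) := by
  set S : Set (EuclideanSpace ℝ (Fin d)) := γ • A 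
  have hS : MeasurableSet S := hA.const_smul₀ γ
  have hball : Metric.ball 0 (γ * r₁) ⊆ S := by
    have h1 := Set.smul_set_mono (a := γ) hA₁
    rwa [smul_ball hγ.ne', smul_zero, Real.norm_of_nonneg hγ.le] at h1
  have hr : 0 < γ * r₁ := mul_pos hγ hr₁
  have h0S : (0 : EuclideanSpace ℝ (Fin d)) ∈ S := hball (Metric.mem_ball_self hr)
  have := Measure.isProbabilityMeasure_map (μ := P) (hαm 0).aemeasurable
  have := Measure.isProbabilityMeasure_map (μ := P) (hξm 0).aemeasurable
  set μα := P.map (α 0) with hμα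
  set μξ := P.map (ξ 0) with hμξ
  have hind := indepFun_drivingPast hαm hξm hα_indep hξ_indep hαξ
  have hlaw := map_prodMk_driving hαm hξm hα_ident hξ_ident hαξ
  set κ := arKernel β μα μξ
  have hαpos : ∀ᵐ a ∂μα, 0 < a := (ae_map_iff (hαm 0).aemeasurable measurableSet_Ioi).2 hα_pos
  have hαl : ∫⁻ a, ‖a‖ₑ ∂μα < 1 := by
    simpa using lintegral_enorm_map_lt_one_of_integral_lt_one (c := 1) (hαm 0) hα_pos
      (by simpa using hα_int) (by simpa using hα_mean)
  have hsupp : 0 < μα (Set.Ico ((d : ℝ) / (d + 1)) 1) := by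
    rw [hμα, Measure.map_apply (hαm 0) measurableSet_Ico]; exact hα_supp
  have hξint : Integrable (fun s => s) μξ :=
    (integrable_map_measure (by fun_prop) (hξm 0).aemeasurable).2
      (hξ_sq.integrable one_le_two)
  have hξmean : ∫ s, s ∂μξ = 0 := by
    rw [hμξ, integral_map (hξm 0).aemeasurable (by fun_prop)]; exact hξ_mean
  obtain ⟨N, ε, ρ, hρ0, hρ1, hcontr⟩ := exists_contraction_arKernel (β := β) hαpos hαl hsupp
    hξint hξmean hS hr hball
  have hWm : Measurable fun x : EuclideanSpace ℝ (Fin d) => ((1 + ε * ‖x‖₊ : NNReal) : ℝ≥0∞) := by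
    fun_prop
  have hW1 : ∀ x : EuclideanSpace ℝ (Fin d), 1 ≤ ((1 + ε * ‖x‖₊ : NNReal) : ℝ≥0∞) := fun x => by
    exact_mod_cast le_self_add
  have hWfin : ∫⁻ x, ((1 + ε * ‖x‖₊ : NNReal) : ℝ≥0∞) ∂κ 0 ≠ ⊤ := by
    push_cast
    rw [lintegral_add_left measurable_const, lintegral_const, measure_univ, mul_one,
      lintegral_const_mul _ (by fun_prop)]
    refine ENNReal.add_ne_top.2 ⟨ENNReal.one_ne_top, ENNReal.mul_ne_top ENNReal.coe_ne_top ?_⟩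
    have hb : ‖β‖ₑ * ∫⁻ s, ‖s‖ₑ ∂μξ ≠ ⊤ := ENNReal.mul_ne_top enorm_ne_top hξint.2.ne
    exact ne_top_of_le_ne_top ENNReal.coe_ne_top (lintegral_nnnorm_arKernel_le
      (ENNReal.coe_toNNReal (hαl.trans ENNReal.one_lt_top).ne).symm
      (ENNReal.coe_toNNReal hb).symm 0)
  obtain ⟨C, r, hr0, hr1, hdec⟩ := exists_geometric_killedStep_iterate hS hWm hW1 hρ0 hρ1 hcontr
    hWfin
  change ∀ n, (excursion κ S 0 n Set.univ).toReal ≤ C * r ^ n at hdec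
  have hMle : ∀ n, excursion κ S 0 n Set.univ ≤ ENNReal.ofReal (C * r ^ n) := fun n => by
    rw [← ENNReal.ofReal_toReal ((excursion_univ_le_one (κ := κ) (S := S) (x₀ := 0)
      n).trans_lt ENNReal.one_lt_top).ne]
    exact ENNReal.ofReal_le_ofReal (hdec n)
  have hfin : cycleOccupation κ S 0 Set.univ ≠ ⊤ := by
    rw [cycleOccupation_apply MeasurableSet.univ]
    refine ne_top_of_le_ne_top ?_ (ENNReal.tsum_le_tsum hMle)
    exact ((summable_geometric_of_lt_one hr0.le hr1).mul_left C).tsum_ofReal_ne_top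
  have hD : ∀ j, MeasurableSet (avoids β S α ξ j) := fun j =>
    pastSigma_le hαm hξm j _ (measurableSet_pastSigma_avoids hS j)
  have htail : ∀ j, P (avoids β S α ξ j) ≤ ENNReal.ofReal (C * r ^ j) := fun j => by
    refine le_of_eq_of_le ?_ (hMle j)
    rw [← measure_avoids_inter_preimage hαm hξm hind hlaw hS j MeasurableSet.univ]
    simp
  have hτ : ∀ᵐ ω ∂P, restartTime β S α ξ ω < ⊤ := ae_restartTime_lt_top hr0 hr1 htail
  have hEτ := lintegral_restartTime (β := β) hαm hξm hind hlaw hS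
  set G := cycleOccupation κ S 0 with hG
  set π₀ : Measure (EuclideanSpace ℝ (Fin d)) := (G Set.univ)⁻¹ • G with hπ₀
  have hπprob : IsProbabilityMeasure π₀ := ⟨by
    rw [hπ₀, Measure.smul_apply, smul_eq_mul]
    exact ENNReal.inv_mul_cancel cycleOccupation_univ_ne_zero hfin⟩
  refine ⟨⟨hτ, exists_lintegral_exp_restartTime_lt_top hr0 hr1 hD htail⟩, ⟨π₀, hπprob⟩,
    fun B hB => ?_, ?_, fun π' hπ' hstat => ?_, fun hap => ?_, fun c hc hαc hαc1 hξc => ?_⟩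
  · have hvisits := lintegral_tsum_visits (β := β) hαm hξm hind hlaw hS hB
    have h2 : π₀ B = (∫⁻ ω, (restartTime β S α ξ ω : ℝ≥0∞) ∂P)⁻¹ * G B := by
      rw [hEτ, hπ₀, Measure.smul_apply, smul_eq_mul]
    refine ⟨h2.trans ?_, h2.trans (by rw [hvisits])⟩
    rw [← hvisits]
    congr 1
    refine lintegral_congr_ae ?_
    filter_upwards [hτ] with ω hω
    exact (sum_Icc_restartTime_eq_tsum hω).symm
  · change (π₀.prod (μα.prod μξ)).map (restartStep β S) = π₀
    rw [map_restartStep hS, hπ₀, regenStep_smul, regenStep_cycleOccupation hS hfin]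
  · have hstat' : regenStep κ S 0 π' = π' := by
      rw [← map_restartStep hS]; exact hstat
    exact eq_smul_cycleOccupation_of_regenStep_eq hstat'
      (tendsto_killedStep_iterate_univ hS hWm hW1 (fun _ => ENNReal.coe_ne_top)
        (ENNReal.ofReal_lt_one.2 hρ1) hcontr π')
  · have hap' : ∀ n, (∀ t, excursion κ S 0 t S ≠ 0 → n ∣ t + 1) → n = 1 := by
      refine fun n hn => hap n fun t ht => ?_
      rcases t with _ | t
      · exact dvd_zero n
      · refine hn t fun h0 => ht ?_
        rw [← measure_avoids_inter_preimage hαm hξm hind hlaw hS t hS] at h0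
        rw [← h0]
        congr 1
        ext ω
        exact restartTime_eq_succ_iff
    have hfinY : ∀ t, IsFiniteMeasure (P.map (restartSeq β S α ξ (t + 1))) := fun t => inferInstance
    have key := tendsto_totalVariation_regenStep hS hr0 hr1 hdec hfin hap'
      (a := fun t => P.map (restartSeq β S α ξ (t + 1))) (π := π₀)
      (map_restartSeq hαm hξm hind hlaw hS h0S) rfl
    exact (tendsto_add_atTop_iff_nat (f := fun t : ℕ =>
      ((P.map (restartSeq β S α ξ t)).toSignedMeasure -
        π₀.toSignedMeasure).totalVariation Set.univ) 1).1 key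
  · have hc0 : 0 < c := by linarith
    have hαlt := lintegral_enorm_map_lt_one_of_integral_lt_one (hαm 0) hα_pos hαc hαc1
    have hξfin : ∫⁻ s, ‖s‖ₑ ^ c ∂μξ ≠ ⊤ := by
      rw [hμξ, lintegral_map (by fun_prop) (hξm 0)]
      have h1 := hξc.2.ne
      simpa [Real.enorm_rpow_of_nonneg (norm_nonneg _) hc0.le] using h1
    obtain ⟨l, b, hl, hb, hdrift⟩ := exists_rpow_drift_arKernel (β := β) hc.le hαlt hξfin
    have hGc := lintegral_cycleOccupation_lt_top (S := S) (x₀ := 0)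
      (V := fun y : EuclideanSpace ℝ (Fin d) => ‖y‖ₑ ^ c) (by fun_prop) hl hb hdrift
      (by simp [hc0]) hfin
    refine ⟨((Real.continuous_rpow_const hc0.le).comp continuous_norm).aestronglyMeasurable, ?_⟩
    change ∫⁻ y, ‖‖y‖ ^ c‖ₑ ∂π₀ < ⊤
    simp only [Real.enorm_rpow_of_nonneg (norm_nonneg _) hc0.le, enorm_norm]
    rw [hπ₀, lintegral_smul_measure, smul_eq_mul]
    exact ENNReal.mul_lt_top (ENNReal.inv_lt_top.2
      (pos_iff_ne_zero.2 cycleOccupation_univ_ne_zero)) hGc
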